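/- **Setting.** All spaces are nonempty. Let $\mathbb{U}$ be the Urysohn space (the complete separable metric space, unique up to isometry, in which every one-point metric extension of a finite subspace is realized), and let $F(\mathbb{U})$ be the collection of its nonempty closed subsets with the Effros Borel structure, i.e. the $\sigma$-algebra generated by the sets $\{F \mid F\cap V\neq\emptyset\}$ with $V\subseteq\mathbb{U}$ open. For a countable set $D\subseteq[0,\infty)$ with $0\in D$, let $$\mathcal{U}_D=\{U\in F(\mathbb{U})\mid d_{\mathbb{U}}\restriction U^2 \text{ is an ultrametric all of whose values belong to } D\}$$ with the induced Borel structure (so $\mathcal{U}_D$ represents the ultrametric Polish spaces with distances in $D$), and let $\cong_D$ and $\sqsubseteq_D$ be the relations of isometry and of isometric embeddability on $\mathcal{U}_D$. For a quasi-order $S$ on $X$, let $E_S$ be the equivalence relation $x\mathrel{E_S}y\iff x\mathrel{S}y\wedge y\mathrel{S}x$, and let $S^{\mathrm{inj}}$ be the quasi-order on ${}^{\omega}X$ (with the product Borel structure) given by $$(x_n)_{n\in\omega}\mathrel{S^{\mathrm{inj}}}(y_n)_{n\in\omega}\iff \text{there is an injective } f\colon\omega\to\omega \text{ with } x_n\mathrel{S}y_{f(n)}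 \text{ for all } n.$$ For relations $R$ on $X$ and $S$ on $Y$, write $R\le_B S$ if there is a Borel map $f\colon X\to Y$ such that $x\mathrel{R}x'\iff f(x)\mathrel{S}f(x')$ for all $x,x'\in X$; $R$ and $S$ are Borel bireducible, $R\sim_B S$, if $R\le_B S$ and $S\le_B R$. **Theorem.** Let $1<\alpha<\omega_1$, and let $D_\alpha, D_{\alpha+1}\subseteq[0,\infty)$ be any countable sets containing $0$ which are well-ordered of order type $\alpha$ and $\alpha+1$, respectively. Write $\cong_\alpha$, $\sqsubseteq_\alpha$ for $\cong_{D_\alpha}$, $\sqsubseteq_{D_\alpha}$, and similarly for $\alpha+1$. Then $${\cong_{\alpha+1}}\sim_B E_{(\cong_\alpha)^{\mathrm{inj}}}\qquad\text{and}\qquad {\sqsubseteq_{\alpha+1}}\sim_B (\sqsubseteq_\alpha)^{\mathrm{inj}}.$$ -/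

import Mathlib

open Set

noncomputable section

/-! ## The Urysohn space

The Urysohn space is built as the completion of a countable pseudometric space with underlying set
`ℕ`. The distances of the point `n + 1` to the points `0, …, n` are obtained from a finite set
of prescribed pairs (point, rational distance bound), all such finite sets being enumerated
infinitely often. That the completion is the Urysohn space, i.e. that it has the one-point extension
property, is `UrysohnSpace.exists_dist_eq`. -/

/-- The one-point extension function `k ↦ min_{(i,q) ∈ s} (q + d(i,k))`. -/
def minExt (d : ℕ → ℕ → ℝ) (s : Finset (ℕ × ℚ)) (hs : s.Nonempty) (k : ℕ) : ℝ :=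
  s.inf' hs fun p => (p.2 : ℝ) + d p.1 k

/-- A finite set of prescribed distance bounds to points `i ≤ n` is admissible if it is compatible
with the triangle inequality. -/
def IsAdmissible (d : ℕ → ℕ → ℝ) (n : ℕ) (s : Finset (ℕ × ℚ)) : Prop :=
  s.Nonempty ∧ (∀ p ∈ s, p.1 ≤ n) ∧ ∀ p ∈ s, ∀ q ∈ s, d p.1 q.1 ≤ (p.2 : ℝ) + q.2

open Classical in
/-- The distance of the new point to the point `k`: the function `minExt` if `s` is admissible, and
the distance from the point `0` otherwise. -/
def newDist (d : ℕ → ℕ → ℝ) (n : ℕ) (s : Finset (ℕ × ℚ)) (k : ℕ) : ℝ :=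
  if h : IsAdmissible d n s then minExt d s h.1 k else d 0 k

theorem newDist_le (d : PseudoMetric ℕ ℝ) (n : ℕ) (s : Finset (ℕ × ℚ)) (k l : ℕ) :
    newDist d n s k ≤ newDist d n s l + d l k := by
  unfold newDist
  split_ifs with h
  · obtain ⟨p, hp, hpe⟩ := s.exists_mem_eq_inf' h.1 fun p => (p.2 : ℝ) + d p.1 l
    have h1 : minExt d s h.1 k ≤ (p.2 : ℝ) + d p.1 k :=
      Finset.inf'_le (fun p : ℕ × ℚ => (p.2 : ℝ) + d p.1 k) hp
    have h2 : minExt d s h.1 l = (p.2 : ℝ) + d p.1 l := hpe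
    have h3 := d.triangle p.1 l k
    linarith
  · exact d.triangle 0 l k

theorem le_newDist_add (d : PseudoMetric ℕ ℝ) (n : ℕ) (s : Finset (ℕ × ℚ)) (k l : ℕ) :
    d k l ≤ newDist d n s k + newDist d n s l := by
  unfold newDist
  split_ifs with h
  · obtain ⟨p, hp, hpe⟩ := s.exists_mem_eq_inf' h.1 fun p => (p.2 : ℝ) + d p.1 k
    obtain ⟨q, hq, hqe⟩ := s.exists_mem_eq_inf' h.1 fun p => (p.2 : ℝ) + d p.1 l
    have h1 : minExt d s h.1 k = (p.2 : ℝ) + d p.1 k := hpe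
    have h2 : minExt d s h.1 l = (q.2 : ℝ) + d q.1 l := hqe
    have h3 := h.2.2 p hp q hq
    have h4 := d.triangle k p.1 l
    have h5 := d.triangle p.1 q.1 l
    have h6 := d.symm k p.1
    linarith
  · have h4 := d.triangle k 0 l
    have h6 := d.symm k 0
    linarith

theorem newDist_nonneg (d : PseudoMetric ℕ ℝ) (n : ℕ) (s : Finset (ℕ × ℚ)) (k : ℕ) :
    0 ≤ newDist d n s k := by
  have h := le_newDist_add d n s k k
  rw [d.refl] at h
  linarith

/-- The pseudometric that agrees with `d` on `0, …, n`, and in which all points `> n` are glued to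
one new point, whose distances to `0, …, n` are given by `newDist`. -/
def extendDist (d : PseudoMetric ℕ ℝ) (n : ℕ) (s : Finset (ℕ × ℚ)) : PseudoMetric ℕ ℝ where
  toFun a b :=
    if a ≤ n then (if b ≤ n then d a b else newDist d n s a)
    else (if b ≤ n then newDist d n s b else 0)
  refl' a := by
    by_cases h : a ≤ n <;> simp [h]
  symm' a b := by
    by_cases ha : a ≤ n <;> by_cases hb : b ≤ n <;> simp [ha, hb, d.symm a b]
  triangle' a b c := by
    have h1 := newDist_le d n s
    have h2 := le_newDist_add d n s
    have h3 := newDist_nonneg d n s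
    by_cases ha : a ≤ n <;> by_cases hb : b ≤ n <;> by_cases hc : c ≤ n <;>
      simp only [ha, hb, hc, if_true, if_false]
    · exact d.triangle a b c
    · have := h1 a b
      rw [d.symm b a] at this
      linarith
    · exact h2 a c
    · linarith
    · have := h1 c b
      linarith
    · linarith [h3 b]
    · linarith
    · linarith

/-- An enumeration of all finite sets of prescribed distance bounds, each one listed infinitely
often. -/
def codeAt (n : ℕ) : Finset (ℕ × ℚ) :=
  (Encodable.decode (n.unpair.2)).getD ∅

/-- At stage `n`, the distances between the points `0, …, n` are final. -/
def stageDist : ℕ → PseudoMetric ℕ ℝ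
  | 0 => ⟨fun _ _ => 0, fun _ => rfl, fun _ _ => rfl, fun _ _ _ => by simp⟩
  | n + 1 => extendDist (stageDist n) n (codeAt n)

theorem stageDist_stable {a b m n : ℕ} (ha : a ≤ m) (hb : b ≤ m) (hmn : m ≤ n) :
    stageDist n a b = stageDist m a b := by
  induction n, hmn using Nat.le_induction with
  | base => rfl
  | succ n hn ih =>
    rw [← ih]
    change (if a ≤ n then (if b ≤ n then stageDist n a b else _) else _) = _
    rw [if_pos (ha.trans hn), if_pos (hb.trans hn)]

/-- The limit of the stages: the distance of `a` and `b` is their distance at any stage `≥ a, b`. -/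
def limitDist : PseudoMetric ℕ ℝ where
  toFun a b := stageDist (max a b) a b
  refl' a := (stageDist _).refl a
  symm' a b := by rw [(stageDist _).symm, max_comm]
  triangle' a b c := by
    have e (x y : ℕ) (hx : x ≤ max (max a b) c) (hy : y ≤ max (max a b) c) :
        stageDist (max x y) x y = stageDist (max (max a b) c) x y :=
      (stageDist_stable (le_max_left _ _) (le_max_right _ _) (max_le hx hy)).symm
    rw [e a c (by simp) (by simp), e a b (by simp) (by simp), e b c (by simp) (by simp)]
    exact (stageDist _).triangle _ _ _

theorem limitDist_eq {a b n : ℕ} (ha : a ≤ n) (hb : b ≤ n) : limitDist a b = stageDist n a b :=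
  (stageDist_stable (le_max_left _ _) (le_max_right _ _) (max_le ha hb)).symm

/-- The countable pseudometric space whose completion is the Urysohn space. -/
structure PreUrysohn : Type where
  idx : ℕ

instance : Countable PreUrysohn :=
  Function.Injective.countable (f := PreUrysohn.idx) fun a b h => by cases a; cases b; simp_all

instance : Nonempty PreUrysohn := ⟨⟨0⟩⟩

instance : PseudoMetricSpace PreUrysohn where
  dist a b := limitDist a.idx b.idx
  dist_self a := limitDist.refl a.idx
  dist_comm a b := limitDist.symm a.idx b.idx
  dist_triangle a b c := limitDist.triangle a.idx b.idx c.idx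

/-- The Urysohn space `𝕌`. -/
abbrev UrysohnSpace : Type := UniformSpace.Completion PreUrysohn

theorem exists_limitDist_eq (s : Finset (ℕ × ℚ)) (hs : s.Nonempty)
    (h : ∀ p ∈ s, ∀ q ∈ s, limitDist p.1 q.1 ≤ (p.2 : ℝ) + q.2) :
    ∃ z : ℕ, ∀ p ∈ s, limitDist z p.1 ≤ p.2 ∧
      ∃ q ∈ s, limitDist z p.1 = q.2 + limitDist q.1 p.1 := by
  obtain ⟨m, hm⟩ : ∃ m, ∀ p ∈ s, p.1 ≤ m :=
    ⟨s.sup Prod.fst, fun p hp => Finset.le_sup (f := Prod.fst) hp⟩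
  set n := Nat.pair m (Encodable.encode s) with hn
  have hmn : m ≤ n := Nat.left_le_pair _ _
  have hcode : codeAt n = s := by simp [codeAt, hn]
  have hadm : IsAdmissible (stageDist n) n s := by
    refine ⟨hs, fun p hp => (hm p hp).trans hmn, fun p hp q hq => ?_⟩
    rw [← limitDist_eq ((hm p hp).trans hmn) ((hm q hq).trans hmn)]
    exact h p hp q hq
  have key : ∀ k ≤ n, limitDist (n + 1) k = minExt (stageDist n) s hs k := by
    intro k hk
    rw [limitDist_eq (n := n + 1) le_rfl (hk.trans (Nat.le_succ n))]
    change (if n + 1 ≤ n then _ else (if k ≤ n then newDist (stageDist n) n (codeAt n) k else 0)) = _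
    rw [if_neg (by omega), if_pos hk, hcode, newDist, dif_pos hadm]
  refine ⟨(n + 1), fun p hp => ?_⟩
  have hpn := (hm p hp).trans hmn
  constructor
  · rw [key _ hpn]
    have h1 : minExt (stageDist n) s hs p.1 ≤ (p.2 : ℝ) + stageDist n p.1 p.1 :=
      Finset.inf'_le (fun q : ℕ × ℚ => (q.2 : ℝ) + stageDist n q.1 p.1) hp
    rw [(stageDist n).refl] at h1
    linarith
  · obtain ⟨q, hq, hqe⟩ := s.exists_mem_eq_inf' hs fun q => (q.2 : ℝ) + stageDist n q.1 p.1
    refine ⟨q, hq, ?_⟩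
    rw [key _ hpn, limitDist_eq ((hm q hq).trans hmn) hpn]
    exact hqe

theorem UrysohnSpace.exists_approx (s : Finset UrysohnSpace) (hs : s.Nonempty)
    (f : UrysohnSpace → ℝ) (hf : ∀ x ∈ s, ∀ y ∈ s, dist x y ≤ f x + f y) {ε : ℝ} (hε : 0 < ε) :
    ∃ z : UrysohnSpace, ∀ x ∈ s, dist z x ≤ f x + ε ∧
      ∃ y ∈ s, f y + dist y x - ε ≤ dist z x := by
  classical
  have hδ : 0 < ε / 4 := by linarith
  have h1 : ∀ x : UrysohnSpace, ∃ a : PreUrysohn, dist x (a : UrysohnSpace) < ε / 4 := by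
    intro x
    exact (UniformSpace.Completion.denseRange_coe (α := PreUrysohn)).exists_dist_lt x hδ
  choose a ha using h1
  have h2 : ∀ x : UrysohnSpace, ∃ q : ℚ, f x + ε / 4 < q ∧ (q : ℝ) < f x + 2 * (ε / 4) :=
    fun x => exists_rat_btwn (by linarith)
  choose q hq1 hq2 using h2
  have hd : ∀ x y : UrysohnSpace, |dist (a x) (a y) - dist x y| ≤ 2 * (ε / 4) := by
    intro x y
    have e1 := dist_triangle4 x (a x : UrysohnSpace) (a y) y
    have e2 := dist_triangle4 (a x : UrysohnSpace) x y (a y)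
    have e3 := ha x
    have e4 := ha y
    rw [UniformSpace.Completion.dist_eq] at e1 e2
    rw [dist_comm (a y : UrysohnSpace) y] at e1
    rw [dist_comm (a x : UrysohnSpace) x] at e2
    rw [abs_le]
    constructor <;> linarith
  obtain ⟨z, hz⟩ := exists_limitDist_eq (s.image fun x => ((a x).idx, q x)) (hs.image _) (by
    intro p hp p' hp'
    obtain ⟨x, hx, rfl⟩ := Finset.mem_image.1 hp
    obtain ⟨y, hy, rfl⟩ := Finset.mem_image.1 hp'
    have := abs_le.1 (hd x y)
    have := hf x hx y hy
    have := hq1 x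
    have := hq1 y
    change dist (a x) (a y) ≤ (q x : ℝ) + q y
    linarith)
  refine ⟨((⟨z⟩ : PreUrysohn) : UrysohnSpace), fun x hx => ?_⟩
  obtain ⟨hz1, p, hp, hz2⟩ := hz _ (Finset.mem_image_of_mem _ hx)
  obtain ⟨y, hy, rfl⟩ := Finset.mem_image.1 hp
  change dist (⟨z⟩ : PreUrysohn) (a x) ≤ (q x : ℝ) at hz1
  change dist (⟨z⟩ : PreUrysohn) (a x) = (q y : ℝ) + dist (a y) (a x) at hz2
  have e1 := dist_triangle ((⟨z⟩ : PreUrysohn) : UrysohnSpace) (a x) x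
  have e2 := dist_triangle ((⟨z⟩ : PreUrysohn) : UrysohnSpace) x (a x)
  rw [UniformSpace.Completion.dist_eq] at e1 e2
  rw [dist_comm (a x : UrysohnSpace) x] at e1
  have e3 := ha x
  have e4 := hq1 y
  have e5 := hq2 x
  have e6 := abs_le.1 (hd y x)
  refine ⟨by linarith, y, hy, by linarith⟩

/-- The Urysohn property: every one-point metric extension of a finite subspace is realized. Together
with completeness and separability, this characterizes the Urysohn space up to isometry. -/
theorem UrysohnSpace.exists_dist_eq (s : Finset UrysohnSpace) (f : UrysohnSpace → ℝ)
    (hf : ∀ x ∈ s, ∀ y ∈ s, |f x - f y| ≤ dist x y ∧ dist x y ≤ f x + f y) :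
    ∃ z : UrysohnSpace, ∀ x ∈ s, dist z x = f x := by
  classical
  rcases s.eq_empty_or_nonempty with rfl | hs
  · exact ⟨(Classical.arbitrary PreUrysohn : PreUrysohn), by simp⟩
  have step : ∀ (ε : ℝ) (y : UrysohnSpace), 0 < ε → (∀ x ∈ s, |dist y x - f x| ≤ ε) →
      ∃ z : UrysohnSpace, (∀ x ∈ s, |dist z x - f x| ≤ ε / 2) ∧ dist y z ≤ 2 * ε := by
    intro ε y hε hy
    have hnn : ∀ x ∈ s, 0 ≤ f x := fun x hx => by
      have := (hf x hx x hx).2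
      rw [dist_self] at this
      linarith
    by_cases hys : y ∈ s
    · obtain ⟨z, hz⟩ := UrysohnSpace.exists_approx s hs f (fun x hx y hy => (hf x hx y hy).2)
        (half_pos hε)
      refine ⟨z, fun x hx => ?_, ?_⟩
      · obtain ⟨h1, w, hw, h2⟩ := hz x hx
        have := (abs_le.1 (hf w hw x hx).1)
        rw [abs_le]
        constructor <;> linarith
      · have h1 := (hz y hys).1
        have h2 := (abs_le.1 (hy y hys)).1
        rw [dist_self] at h2
        rw [dist_comm]
        linarith
    · set g : UrysohnSpace → ℝ := fun x => if x = y then ε else f x with hg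
      have hgy : g y = ε := by simp [hg]
      have hgs : ∀ x ∈ s, g x = f x := fun x hx => by
        have : x ≠ y := fun h => hys (h ▸ hx)
        simp [hg, this]
      obtain ⟨z, hz⟩ := UrysohnSpace.exists_approx (insert y s) (Finset.insert_nonempty _ _) g (by
        intro u hu v hv
        rcases Finset.mem_insert.1 hu with hu | hu <;> rcases Finset.mem_insert.1 hv with hv | hv
        · rw [hu, hv, dist_self, hgy]; linarith
        · rw [hu, hgy, hgs v hv]
          have := abs_le.1 (hy v hv)
          linarith
        · rw [hv, hgy, hgs u hu, dist_comm]
          have := abs_le.1 (hy u hu)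
          linarith
        · rw [hgs u hu, hgs v hv]
          exact (hf u hu v hv).2) (half_pos hε)
      refine ⟨z, fun x hx => ?_, ?_⟩
      · obtain ⟨h1, w, hw, h2⟩ := hz x (Finset.mem_insert_of_mem hx)
        rw [hgs x hx] at h1
        rw [abs_le]
        refine ⟨?_, by linarith⟩
        rcases Finset.mem_insert.1 hw with rfl | hw
        · rw [hgy] at h2
          have := abs_le.1 (hy x hx)
          linarith
        · rw [hgs w hw] at h2
          have := (abs_le.1 (hf w hw x hx).1)
          linarith
      · have h1 := (hz y (Finset.mem_insert_self _ _)).1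
        rw [hgy] at h1
        rw [dist_comm]
        linarith
  obtain ⟨z₀, hz₀⟩ := UrysohnSpace.exists_approx s hs f (fun x hx y hy => (hf x hx y hy).2) one_pos
  have hz₀' : ∀ x ∈ s, |dist z₀ x - f x| ≤ (1 : ℝ) := by
    intro x hx
    obtain ⟨h1, w, hw, h2⟩ := hz₀ x hx
    have := (abs_le.1 (hf w hw x hx).1)
    rw [abs_le]
    constructor <;> linarith
  have hpos : ∀ n : ℕ, (0 : ℝ) < (1 / 2) ^ n := fun n => by positivity
  let P : ℕ → UrysohnSpace → Prop := fun n y => ∀ x ∈ s, |dist y x - f x| ≤ (1 / 2 : ℝ) ^ n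
  have : Nonempty UrysohnSpace := ⟨z₀⟩
  choose! nxt hn1 hn2 using step
  let u : ℕ → UrysohnSpace := fun n => Nat.rec z₀ (fun n y => nxt ((1 / 2) ^ n) y) n
  have hu : ∀ n, P n (u n) := by
    intro n
    induction n with
    | zero => simpa [P, u] using hz₀'
    | succ n ih =>
      intro x hx
      have := hn1 _ _ (hpos n) ih x hx
      rw [pow_succ]
      have e : u (n + 1) = nxt ((1 / 2) ^ n) (u n) := rfl
      rw [e]
      linarith
  have hud : ∀ n, dist (u n) (u (n + 1)) ≤ 2 * (1 / 2 : ℝ) ^ n := fun n => hn2 _ _ (hpos n) (hu n)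
  obtain ⟨z, hz⟩ := cauchySeq_tendsto_of_complete
    (cauchySeq_of_le_geometric (1 / 2) 2 (by norm_num) hud)
  refine ⟨z, fun x hx => ?_⟩
  have t1 : Filter.Tendsto (fun n => |dist (u n) x - f x|) Filter.atTop (nhds |dist z x - f x|) :=
    ((hz.dist tendsto_const_nhds).sub_const _).abs
  have t2 : Filter.Tendsto (fun n : ℕ => (1 / 2 : ℝ) ^ n) Filter.atTop (nhds 0) :=
    tendsto_pow_atTop_nhds_zero_of_lt_one (by norm_num) (by norm_num)
  have := le_of_tendsto_of_tendsto' t1 t2 fun n => hu n x hx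
  have h0 : |dist z x - f x| = 0 := le_antisymm this (abs_nonneg _)
  linarith [abs_eq_zero.1 h0]

/-- The Urysohn space is a Polish metric space. -/
theorem UrysohnSpace.polish :
    CompleteSpace UrysohnSpace ∧ TopologicalSpace.SeparableSpace UrysohnSpace :=
  ⟨inferInstance, inferInstance⟩

/-! ## The space of nonempty closed sets -/

/-- The collection `F(X)` of nonempty closed subsets of `X`. -/
def ClosedSubsets (X : Type*) [TopologicalSpace X] : Type _ :=
  {F : Set X // IsClosed F ∧ F.Nonempty}

/-- The Effros Borel structure: the σ-algebra generated by the sets `{F | F ∩ V ≠ ∅}`, `V` open. -/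
instance (X : Type*) [TopologicalSpace X] : MeasurableSpace (ClosedSubsets X) :=
  MeasurableSpace.generateFrom
    {A | ∃ V : Set X, IsOpen V ∧ A = {F : ClosedSubsets X | (F.1 ∩ V).Nonempty}}

/-! ## Ultrametric Polish spaces with distances in a given set -/

open scoped NNReal

/-- The collection `𝒟` of the countable sets of nonnegative reals containing `0`. -/
def DistanceSets : Set (Set ℝ≥0) := {D | D.Countable ∧ 0 ∈ D}

/-- `U_D`: the nonempty closed subspaces of the Urysohn space which are ultrametric and all of whose
distances are in `D`, with the Borel structure induced by the Effros Borel structure. -/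
def UltraPolish (D : Set ℝ≥0) : Set (ClosedSubsets UrysohnSpace) :=
  {F | IsUltrametricDist F.1 ∧ ∀ x ∈ F.1, ∀ y ∈ F.1, nndist x y ∈ D}

/-- Isometry on `U_D`. -/
def isomOn (D : Set ℝ≥0) (U V : UltraPolish D) : Prop :=
  Nonempty (U.1.1 ≃ᵢ V.1.1)

/-- Isometric embeddability on `U_D`. -/
def embedsOn (D : Set ℝ≥0) (U V : UltraPolish D) : Prop :=
  ∃ φ : U.1.1 → V.1.1, Isometry φ

/-! ## Jump operator and Borel reducibility -/

/-- The jump `S ↦ S^inj`. -/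
def injJump {X : Type*} (S : X → X → Prop) (x y : ℕ → X) : Prop :=
  ∃ f : ℕ → ℕ, Function.Injective f ∧ ∀ n, S (x n) (y (f n))

/-- The equivalence relation `E_S` associated to a quasi-order `S`. -/
def assocEquiv {X : Type*} (S : X → X → Prop) (x y : X) : Prop := S x y ∧ S y x

/-- Borel reducibility `R ≤_B S`. -/
def BorelReducible {X Y : Type*} [MeasurableSpace X] [MeasurableSpace Y]
    (R : X → X → Prop) (S : Y → Y → Prop) : Prop :=
  ∃ f : X → Y, Measurable f ∧ ∀ x x', R x x' ↔ S (f x) (f x')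

/-- Borel bireducibility `R ∼_B S`. -/
def BorelBireducible {X Y : Type*} [MeasurableSpace X] [MeasurableSpace Y]
    (R : X → X → Prop) (S : Y → Y → Prop) : Prop :=
  BorelReducible R S ∧ BorelReducible S R

end

open scoped NNReal

/-! ## Measurable selection -/

section Selection

variable {A Y : Type*} [MeasurableSpace A] [MetricSpace Y]

/-! A well-ordered distance set has a gap above `0`, so a space in `UltraPolish D` is uniformly
discrete. Hence any dense sequence enumerates all of it, and the space is given by an ultrametric
distance matrix on `ℕ`, an `UltraCode D`, in which repetitions are allowed. Passing from closed sets
to codes is Borel because dense sequences can be selected measurably. Passing back is Borel because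
the inductive embedding into the Urysohn space can be done by measurable selection
(`exists_measurable_code`, `exists_measurable_space`).

For codes only the order of the distances matters, and a set of type `α + 1` is a set `L` of type
`α` with a top element added. In a code over `WithTop L`, having distance `< ⊤` is an equivalence
relation. Its classes, the pieces, are codes over `L`, and different pieces are exactly `⊤` apart.
So an embedding amounts to an injection between the sets of pieces together with an embedding of
each piece into its image (`exists_emb_piece`, `emb_of_emb_piece`). For isometries the injection is
a bijection, and the Schröder–Bernstein argument turns injections in both directions into one. The
parameter `s` of `Emb` treats embeddings and isometries at once.

A sequence of spaces is therefore encoded by its disjoint union `sum`. Conversely, a space yields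
the sequence of its pieces. As there may be only finitely many of them, the sequence is padded with
one-point spaces. To keep padding and pieces apart, each piece is first thickened to a space with at
least two points, reversibly with respect to `Emb` (`exists_thicken`). This is possible because `1 <
α` provides a nonzero distance. -/

theorem exists_measurable_refine {q : ℕ → Y} (hq : DenseRange q) {Φ : A → Set Y}
    (hΦ : ∀ y r, MeasurableSet {a | (Φ a ∩ Metric.ball y r).Nonempty}) {ε : ℝ} (hε : 0 < ε)
    {n : A → ℕ} (hn : Measurable n) (h : ∀ a, (Φ a ∩ Metric.ball (q (n a)) ε).Nonempty) :
    ∃ n' : A → ℕ, Measurable n' ∧ (∀ a, (Φ a ∩ Metric.ball (q (n' a)) (ε / 2)).Nonempty) ∧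
      ∀ a, dist (q (n a)) (q (n' a)) ≤ 2 * ε := by
  classical
  -- A point of `Φ a` within `ε` of the current approximation is within `ε / 2` of some `q m`.
  -- Taking the least such `m` makes the choice measurable.
  have hex : ∀ a, ∃ m, (Φ a ∩ Metric.ball (q m) (ε / 2)).Nonempty ∧
      dist (q (n a)) (q m) ≤ 2 * ε := by
    intro a
    obtain ⟨x, hx, hxn⟩ := h a
    obtain ⟨m, hm⟩ := hq.exists_dist_lt x (half_pos hε)
    refine ⟨m, ⟨x, hx, hm⟩, ?_⟩
    have := dist_triangle (q (n a)) x (q m)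
    rw [Metric.mem_ball, dist_comm] at hxn
    linarith
  refine ⟨fun a => Nat.find (hex a), measurable_find hex fun m => ?_, ?_, ?_⟩
  · exact (hΦ _ _).inter (hn (MeasurableSet.of_discrete (s := {k | dist (q k) (q m) ≤ 2 * ε})))
  · exact fun a => (Nat.find_spec (hex a)).1
  · exact fun a => (Nat.find_spec (hex a)).2

/-- The Kuratowski–Ryll-Nardzewski measurable selection theorem. -/
theorem exists_measurable_selection [MeasurableSpace Y] [BorelSpace Y] [CompleteSpace Y]
    [TopologicalSpace.SeparableSpace Y] [Nonempty Y] {Φ : A → Set Y}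
    (hc : ∀ a, IsClosed (Φ a)) (hne : ∀ a, (Φ a).Nonempty)
    (hΦ : ∀ y r, MeasurableSet {a | (Φ a ∩ Metric.ball y r).Nonempty}) :
    ∃ g : A → Y, Measurable g ∧ ∀ a, g a ∈ Φ a := by
  classical
  set q := TopologicalSpace.denseSeq Y
  have hq : DenseRange q := TopologicalSpace.denseRange_denseSeq Y
  -- The approximations at stage `k` are within `(1 / 2) ^ k` of `Φ a` and move by at most `2 * (1 /
  -- 2) ^ k`, so they converge to a point of the closed set `Φ a`.
  let P : ℕ → (A → ℕ) → Prop := fun k n =>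
    Measurable n ∧ ∀ a, (Φ a ∩ Metric.ball (q (n a)) ((1 / 2) ^ k)).Nonempty
  have h0 : ∃ n, P 0 n := by
    have hex : ∀ a, ∃ m, (Φ a ∩ Metric.ball (q m) ((1 / 2) ^ 0)).Nonempty := by
      intro a
      obtain ⟨x, hx⟩ := hne a
      obtain ⟨m, hm⟩ := hq.exists_dist_lt x (show (0 : ℝ) < (1 / 2) ^ 0 by norm_num)
      exact ⟨m, x, hx, hm⟩
    exact ⟨fun a => Nat.find (hex a), measurable_find hex fun m => hΦ _ _,
      fun a => Nat.find_spec (hex a)⟩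
  have hs : ∀ k n, P k n → ∃ n', P (k + 1) n' ∧
      ∀ a, dist (q (n a)) (q (n' a)) ≤ 2 * (1 / 2) ^ k := by
    rintro k n ⟨hn, h⟩
    obtain ⟨n', h1, h2, h3⟩ := exists_measurable_refine hq hΦ (by positivity) hn h
    refine ⟨n', ⟨h1, ?_⟩, h3⟩
    rw [pow_succ, mul_one_div]
    exact h2
  obtain ⟨n0, hn0⟩ := h0
  choose! nxt hnxt hdist using hs
  let n : ℕ → A → ℕ := fun k => Nat.rec n0 (fun k m => nxt k m) k
  have hn : ∀ k, P k (n k) := by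
    intro k
    induction k with
    | zero => exact hn0
    | succ k ih => exact hnxt k _ ih
  have hd : ∀ a k, dist (q (n k a)) (q (n (k + 1) a)) ≤ 2 * (1 / 2 : ℝ) ^ k :=
    fun a k => hdist k _ (hn k) a
  have hlim : ∀ a, ∃ z, Filter.Tendsto (fun k => q (n k a)) Filter.atTop (nhds z) := fun a =>
    cauchySeq_tendsto_of_complete (cauchySeq_of_le_geometric (1 / 2) 2 (by norm_num) (hd a))
  choose g hg using hlim
  refine ⟨g, measurable_of_tendsto_metrizable (f := fun k a => q (n k a)) (fun k => ?_)
    (tendsto_pi_nhds.2 hg), fun a => ?_⟩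
  · exact measurable_from_top.comp (hn k).1
  · choose p hp hpd using fun k => (hn k).2 a
    refine (hc a).mem_of_tendsto (f := p) (b := Filter.atTop) ?_ (Filter.Eventually.of_forall hp)
    refine (tendsto_iff_of_dist (f₁ := fun k => q (n k a)) ?_).1 (hg a)
    refine squeeze_zero (fun _ => dist_nonneg) (fun k => ?_)
      (tendsto_pow_atTop_nhds_zero_of_lt_one (r := (1 / 2 : ℝ)) (by norm_num) (by norm_num))
    rw [dist_comm]
    exact (hpd k).le

theorem measurableSet_inter_nonempty {V : Set Y} (hV : IsOpen V) :
    MeasurableSet {F : ClosedSubsets Y | (F.1 ∩ V).Nonempty} :=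
  MeasurableSpace.measurableSet_generateFrom ⟨V, hV, rfl⟩

/-- Closed sets have dense sequences depending measurably on the set. -/
theorem exists_measurable_dense_seq [MeasurableSpace Y] [BorelSpace Y] [CompleteSpace Y]
    [TopologicalSpace.SeparableSpace Y] [Nonempty Y] :
    ∃ s : ℕ → ClosedSubsets Y → Y, (∀ n, Measurable (s n)) ∧ (∀ n F, s n F ∈ F.1) ∧
      ∀ F : ClosedSubsets Y, ∀ x ∈ F.1, ∀ ε > 0, ∃ n, dist x (s n F) < ε := by
  classical
  have key : ∀ (y : Y) (r : ℝ), ∃ s : ClosedSubsets Y → Y, Measurable s ∧ (∀ F, s F ∈ F.1) ∧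
      ∀ F : ClosedSubsets Y, (F.1 ∩ Metric.ball y r).Nonempty → dist (s F) y ≤ r := by
    intro y r
    -- The closure makes the values closed, as selection requires, and does not change which open
    -- sets are met. The price is only `≤ r` instead of `< r` below.
    let Φ : ClosedSubsets Y → Set Y := fun F =>
      if (F.1 ∩ Metric.ball y r).Nonempty then closure (F.1 ∩ Metric.ball y r) else F.1
    obtain ⟨s, hs, hsΦ⟩ := exists_measurable_selection (Φ := Φ)
      (fun F => by
        by_cases h : (F.1 ∩ Metric.ball y r).Nonempty
        · simp [Φ, h]
        · simpa only [Φ, h, if_false] using F.2.1)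
      (fun F => by
        by_cases h : (F.1 ∩ Metric.ball y r).Nonempty
        · simp only [Φ, h, if_true, closure_nonempty_iff]
        · simpa only [Φ, h, if_false] using F.2.2)
      (fun z t => by
        have e : {F | (Φ F ∩ Metric.ball z t).Nonempty} =
            ({F | (F.1 ∩ (Metric.ball y r ∩ Metric.ball z t)).Nonempty}) ∪
            ({F | (F.1 ∩ Metric.ball y r).Nonempty}ᶜ ∩
              {F | (F.1 ∩ Metric.ball z t).Nonempty}) := by
          ext F
          by_cases h : (F.1 ∩ Metric.ball y r).Nonempty
          · simp only [mem_ofPred_eq, Φ, h, if_true, mem_union, mem_inter_iff, mem_compl_iff,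
              not_true_eq_false, false_and, or_false]
            rw [closure_inter_open_nonempty_iff Metric.isOpen_ball, inter_assoc]
          · have h' : ¬ (F.1 ∩ (Metric.ball y r ∩ Metric.ball z t)).Nonempty := fun h' =>
              h (h'.mono (by rw [← inter_assoc]; exact inter_subset_left))
            simp only [mem_ofPred_eq, Φ, h, if_false, mem_union, mem_inter_iff, mem_compl_iff,
              not_false_eq_true, true_and, h', false_or]
        rw [e]
        exact (measurableSet_inter_nonempty (Metric.isOpen_ball.inter Metric.isOpen_ball)).union
          ((measurableSet_inter_nonempty Metric.isOpen_ball).compl.inter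
            (measurableSet_inter_nonempty Metric.isOpen_ball)))
    refine ⟨s, hs, fun F => ?_, fun F h => ?_⟩
    · have := hsΦ F
      by_cases h : (F.1 ∩ Metric.ball y r).Nonempty
      · simp only [Φ, h, if_true] at this
        exact closure_minimal inter_subset_left F.2.1 this
      · simpa only [Φ, h, if_false] using this
    · have := hsΦ F
      simp only [Φ, h, if_true] at this
      exact closure_minimal (inter_subset_right.trans Metric.ball_subset_closedBall)
        Metric.isClosed_closedBall this
  choose s hs hsm hsd using key
  set q := TopologicalSpace.denseSeq Y
  have hq : DenseRange q := TopologicalSpace.denseRange_denseSeq Y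
  refine ⟨fun n => s (q n.unpair.1) (1 / ((n.unpair.2 : ℝ) + 1)), fun n => hs _ _,
    fun n F => hsm _ _ F, fun F x hx ε hε => ?_⟩
  obtain ⟨k, hk⟩ := exists_nat_one_div_lt (half_pos hε)
  obtain ⟨m, hm⟩ := hq.exists_dist_lt x (show (0 : ℝ) < 1 / ((k : ℝ) + 1) by positivity)
  refine ⟨Nat.pair m k, ?_⟩
  simp only [Nat.unpair_pair]
  have h1 := hsd (q m) (1 / ((k : ℝ) + 1)) F ⟨x, hx, hm⟩
  have h2 := dist_triangle x (q m) (s (q m) (1 / ((k : ℝ) + 1)) F)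
  rw [dist_comm (s _ _ F)] at h1
  linarith

end Selection

/-! ## Measurable embeddings into the Urysohn space -/

noncomputable instance : MeasurableSpace UrysohnSpace := borel _

instance : BorelSpace UrysohnSpace := ⟨rfl⟩

instance : Nonempty UrysohnSpace := ⟨(Classical.arbitrary PreUrysohn : PreUrysohn)⟩

/-- If `f` prescribes the distances of a new point to the points `u i` for `i ≤ n`, then a
realization of `f` is to be found at distance `max_i |dist q (u i) - f i|` from `q`. -/
theorem UrysohnSpace.exists_dist_eq_near {n : ℕ} {u : ℕ → UrysohnSpace} {f : ℕ → ℝ}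
    (hf : ∀ i ≤ n, ∀ j ≤ n, |f i - f j| ≤ dist (u i) (u j) ∧ dist (u i) (u j) ≤ f i + f j)
    (q : UrysohnSpace) {r : ℝ} (hr : ∀ i ≤ n, |dist q (u i) - f i| < r) :
    ∃ z, (∀ i ≤ n, dist z (u i) = f i) ∧ dist z q < r := by
  classical
  obtain ⟨j, hj, hjm⟩ := (Finset.range (n + 1)).exists_max_image
    -- The largest defect `t` is the smallest distance to `q` that a realization of `f` can have.
    -- Prescribing the distance `t` to `q` in addition to `f` respects the triangle inequalities.
    (fun i => |dist q (u i) - f i|) ⟨0, by simp⟩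
  have hj' : j ≤ n := by simpa [Nat.lt_succ_iff] using hj
  set t := |dist q (u j) - f j| with ht
  have htm : ∀ i ≤ n, |dist q (u i) - f i| ≤ t := fun i hi =>
    hjm i (by simpa [Nat.lt_succ_iff] using hi)
  have htu : ∀ i ≤ n, t ≤ dist q (u i) + f i := by
    intro i hi
    have h1 := hf i hi j hj'
    have h2 := dist_triangle q (u i) (u j)
    have h3 := dist_triangle (u i) q (u j)
    rw [dist_comm (u i) q] at h3
    have h4 := abs_le.1 h1.1
    rw [ht, abs_le]
    constructor <;> linarith
  -- The points `u i` may repeat; the choice of index is harmless since `hf` forces `f` to agree on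
  -- repetitions.
  let g : UrysohnSpace → ℝ := fun x =>
    if h : ∃ i, i ≤ n ∧ u i = x then f h.choose else t
  have hgu : ∀ i ≤ n, g (u i) = f i := by
    intro i hi
    have h : ∃ k, k ≤ n ∧ u k = u i := ⟨i, hi, rfl⟩
    have h1 := (hf h.choose h.choose_spec.1 i hi).1
    rw [h.choose_spec.2, dist_self] at h1
    have h2 : g (u i) = f h.choose := dif_pos h
    rw [h2]
    have := abs_nonneg (f h.choose - f i)
    have h3 := abs_eq_zero.1 (le_antisymm h1 this)
    linarith
  -- If `q = u k`, its distance is already prescribed as `f k`, which is its own defect and so `<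
  -- r`.
  by_cases hq : ∃ i, i ≤ n ∧ u i = q
  · obtain ⟨k, hk, rfl⟩ := hq
    obtain ⟨z, hz⟩ := UrysohnSpace.exists_dist_eq ((Finset.range (n + 1)).image u) g (by
      intro x hx y hy
      obtain ⟨a, ha, rfl⟩ := Finset.mem_image.1 hx
      obtain ⟨b, hb, rfl⟩ := Finset.mem_image.1 hy
      have ha' : a ≤ n := by simpa [Nat.lt_succ_iff] using ha
      have hb' : b ≤ n := by simpa [Nat.lt_succ_iff] using hb
      rw [hgu a ha', hgu b hb']
      exact hf a ha' b hb')
    have hz' : ∀ i ≤ n, dist z (u i) = f i := fun i hi => by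
      rw [hz (u i) (Finset.mem_image_of_mem _ (by simpa [Nat.lt_succ_iff] using hi)), hgu i hi]
    refine ⟨z, hz', ?_⟩
    have := hr k hk
    rw [dist_self, zero_sub, abs_neg] at this
    rw [hz' k hk]
    exact (le_abs_self _).trans_lt this
  · have hgq : g q = t := dif_neg hq
    have hmix : ∀ a ≤ n, |f a - t| ≤ dist (u a) q ∧ dist (u a) q ≤ f a + t := by
      intro a ha
      have h1 := abs_le.1 (htm a ha)
      have h2 := htu a ha
      rw [dist_comm (u a) q, abs_le]
      refine ⟨⟨?_, ?_⟩, ?_⟩ <;> linarith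
    obtain ⟨z, hz⟩ := UrysohnSpace.exists_dist_eq (insert q ((Finset.range (n + 1)).image u)) g (by
      have hu : ∀ x ∈ (Finset.range (n + 1)).image u, ∃ a ≤ n, u a = x := by
        intro x hx
        obtain ⟨a, ha, rfl⟩ := Finset.mem_image.1 hx
        exact ⟨a, by simpa [Nat.lt_succ_iff] using ha, rfl⟩
      intro x hx y hy
      rcases Finset.mem_insert.1 hx with hxq | hx <;> rcases Finset.mem_insert.1 hy with hyq | hy
      · rw [hxq, hyq, sub_self, dist_self, abs_zero, hgq]
        exact ⟨le_rfl, add_nonneg (abs_nonneg _) (abs_nonneg _)⟩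
      · obtain ⟨a, ha, rfl⟩ := hu _ hy
        rw [hxq, hgq, hgu a ha, dist_comm, abs_sub_comm, add_comm]
        exact hmix a ha
      · obtain ⟨a, ha, rfl⟩ := hu _ hx
        rw [hyq, hgq, hgu a ha]
        exact hmix a ha
      · obtain ⟨a, ha, rfl⟩ := hu _ hx
        obtain ⟨b, hb, rfl⟩ := hu _ hy
        rw [hgu a ha, hgu b hb]
        exact hf a ha b hb)
    refine ⟨z, fun i hi => ?_, ?_⟩
    · rw [hz (u i) (Finset.mem_insert_of_mem (Finset.mem_image_of_mem _
        (by simpa [Nat.lt_succ_iff] using hi))), hgu i hi]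
    · rw [hz q (Finset.mem_insert_self _ _), hgq]
      exact hr j hj'

/-- By `exists_dist_eq_near`, the set of realizations meets the ball of radius `r` about `y` exactly
when all the defects at `y` are `< r`. This is a finite conjunction of measurable conditions, so
measurable selection applies. -/
theorem UrysohnSpace.exists_measurable_extension {A : Type*} [MeasurableSpace A] {n : ℕ}
    {u : ℕ → A → UrysohnSpace} (hu : ∀ i, Measurable (u i)) {f : ℕ → A → ℝ}
    (hfm : ∀ i, Measurable (f i))
    (hf : ∀ a, ∀ i ≤ n, ∀ j ≤ n, |f i a - f j a| ≤ dist (u i a) (u j a) ∧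
      dist (u i a) (u j a) ≤ f i a + f j a) :
    ∃ z : A → UrysohnSpace, Measurable z ∧ ∀ a, ∀ i ≤ n, dist (z a) (u i a) = f i a := by
  let Φ : A → Set UrysohnSpace := fun a => {z | ∀ i ≤ n, dist z (u i a) = f i a}
  have hball : ∀ y r, {a | (Φ a ∩ Metric.ball y r).Nonempty} =
      ⋂ i ≤ n, {a | |dist y (u i a) - f i a| < r} := by
    intro y r
    ext a
    simp only [mem_ofPred_eq, mem_iInter]
    constructor
    · rintro ⟨z, hz, hzr⟩ i hi
      refine lt_of_le_of_lt ?_ hzr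
      rw [← hz i hi, dist_comm z y]
      exact abs_dist_sub_le y z (u i a)
    · intro h
      obtain ⟨z, hz, hzr⟩ := UrysohnSpace.exists_dist_eq_near (u := fun i => u i a)
        (f := fun i => f i a) (hf a) y h
      exact ⟨z, hz, hzr⟩
  obtain ⟨z, hz, hzΦ⟩ := exists_measurable_selection (Φ := Φ)
    (fun a => by
      have : Φ a = ⋂ i, ⋂ (_ : i ≤ n), {z | dist z (u i a) = f i a} := by
        ext z; simp [Φ]
      rw [this]
      exact isClosed_iInter fun i => isClosed_iInter fun _ =>
        isClosed_eq (continuous_id.dist continuous_const) continuous_const)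
    (fun a => by
      obtain ⟨q⟩ := (inferInstance : Nonempty UrysohnSpace)
      obtain ⟨z, hz, -⟩ := UrysohnSpace.exists_dist_eq_near (u := fun i => u i a)
        (f := fun i => f i a) (hf a) q
        -- Any radius above all defects would do, since only nonemptiness is wanted.
        (r := ∑ i ∈ Finset.range (n + 1), |dist q (u i a) - f i a| + 1) (fun i hi => by
          have := Finset.single_le_sum (f := fun i => |dist q (u i a) - f i a|)
            (fun i _ => abs_nonneg _) (Finset.mem_range.2 (Nat.lt_succ_of_le hi))
          linarith)
      exact ⟨z, hz⟩)
    (fun y r => by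
      rw [hball]
      refine MeasurableSet.iInter fun i => MeasurableSet.iInter fun _ => ?_
      exact measurableSet_lt (continuous_abs.measurable.comp
        ((measurable_const.dist (hu i)).sub (hfm i))) measurable_const)
  exact ⟨z, hz, hzΦ⟩

/-- Pseudometrics on `ℕ` embed isometrically into the Urysohn space, in a measurable way. -/
theorem UrysohnSpace.exists_measurable_embedding {A : Type*} [MeasurableSpace A]
    (d : A → PseudoMetric ℕ ℝ) (hd : ∀ i j, Measurable fun a => d a i j) :
    ∃ u : ℕ → A → UrysohnSpace, (∀ i, Measurable (u i)) ∧
      ∀ a i j, dist (u i a) (u j a) = d a i j := by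
  let P : ℕ → (ℕ → A → UrysohnSpace) → Prop := fun n u => (∀ i, Measurable (u i)) ∧
    ∀ a, ∀ i ≤ n, ∀ j ≤ n, dist (u i a) (u j a) = d a i j
  have h0 : ∃ u, P 0 u := by
    obtain ⟨q⟩ := (inferInstance : Nonempty UrysohnSpace)
    refine ⟨fun _ _ => q, fun _ => measurable_const, fun a i hi j hj => ?_⟩
    rw [Nat.le_zero.1 hi, Nat.le_zero.1 hj, dist_self, (d a).refl]
  have hs : ∀ n u, P n u → ∃ u', P (n + 1) u' ∧ ∀ i ≤ n, u' i = u i := by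
    rintro n u ⟨hu, hud⟩
    obtain ⟨z, hz, hzd⟩ := UrysohnSpace.exists_measurable_extension (n := n) hu
      (f := fun i a => d a (n + 1) i) (fun i => hd _ _) (fun a i hi j hj => by
        rw [hud a i hi j hj, abs_le]
        have h1 := (d a).triangle (n + 1) i j
        have h2 := (d a).triangle (n + 1) j i
        have h3 := (d a).triangle i (n + 1) j
        rw [(d a).symm j i] at h2
        rw [(d a).symm i (n + 1)] at h3
        refine ⟨⟨?_, ?_⟩, ?_⟩ <;> linarith)
    have e1 : Function.update u (n + 1) z (n + 1) = z := Function.update_self _ _ _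
    have e2 : ∀ i ≤ n, Function.update u (n + 1) z i = u i := fun i hi =>
      Function.update_of_ne (by omega) _ _
    refine ⟨Function.update u (n + 1) z, ⟨fun i => ?_, fun a i hi j hj => ?_⟩, e2⟩
    · by_cases h : i = n + 1
      · rw [h, e1]; exact hz
      · rw [Function.update_of_ne h]; exact hu i
    · rcases Nat.le_succ_iff.1 hi with hi | rfl <;> rcases Nat.le_succ_iff.1 hj with hj | rfl
      · rw [e2 i hi, e2 j hj]; exact hud a i hi j hj
      · rw [e2 i hi, e1, dist_comm, hzd a i hi, (d a).symm]
      · rw [e2 j hj, e1, hzd a j hj]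
      · rw [dist_self, (d a).refl]
  obtain ⟨u0, hu0⟩ := h0
  choose! nxt hnxt hstab using hs
  -- Stage `n + 1` leaves the points `0, …, n` alone, so the diagonal `w i i` is the limit of the
  -- stages.
  let w : ℕ → ℕ → A → UrysohnSpace := fun n => Nat.rec u0 (fun n v => nxt n v) n
  have hw : ∀ n, P n (w n) := by
    intro n
    induction n with
    | zero => exact hu0
    | succ n ih => exact hnxt n _ ih
  have hst : ∀ i n, i ≤ n → w n i = w i i := by
    intro i n hin
    induction n, hin using Nat.le_induction with
    | base => rfl
    | succ n hn ih => rw [← ih]; exact hstab n _ (hw n) i hn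
  refine ⟨fun i => w i i, fun i => (hw i).1 i, fun a i j => ?_⟩
  change dist (w i i a) (w j j a) = _
  rw [← hst i _ (le_max_left i j), ← hst j _ (le_max_right i j)]
  exact (hw _).2 a i (le_max_left i j) j (le_max_right i j)

/-! ## Codes for countable ultrametric spaces -/

/-- Ultrametric pseudometrics on `ℕ` with distances in a linear order with least element, serving as
codes for nonempty countable ultrametric spaces. -/
structure UltraCode (L : Type*) [LinearOrder L] [OrderBot L] where
  /-- The distance of two points. -/
  toFun : ℕ → ℕ → L
  self' : ∀ i, toFun i i = ⊥
  symm' : ∀ i j, toFun i j = toFun j i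
  triangle' : ∀ i j k, toFun i k ≤ max (toFun i j) (toFun j k)

namespace UltraCode

section Basic

variable {L : Type*} [LinearOrder L] [OrderBot L]

instance : CoeFun (UltraCode L) fun _ => ℕ → ℕ → L := ⟨toFun⟩

theorem self (ρ : UltraCode L) (i : ℕ) : ρ i i = ⊥ := ρ.self' i

theorem symm (ρ : UltraCode L) (i j : ℕ) : ρ i j = ρ j i := ρ.symm' i j

theorem triangle (ρ : UltraCode L) (i j k : ℕ) : ρ i k ≤ max (ρ i j) (ρ j k) := ρ.triangle' i j k

theorem congr_right (ρ : UltraCode L) {i j k : ℕ} (h : ρ j k = ⊥) : ρ i j = ρ i k := by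
  have h1 := ρ.triangle i j k
  have h2 := ρ.triangle i k j
  rw [ρ.symm k j] at h2
  rw [h, max_bot_right] at h1 h2
  exact le_antisymm h2 h1

theorem congr (ρ : UltraCode L) {i i' j j' : ℕ} (hi : ρ i i' = ⊥) (hj : ρ j j' = ⊥) :
    ρ i j = ρ i' j' := by
  rw [ρ.congr_right hj, ρ.symm i, ρ.congr_right hi, ρ.symm]

/-- The code of the one-point space. -/
def point : UltraCode L := ⟨fun _ _ => ⊥, fun _ => rfl, fun _ _ => rfl, fun _ _ _ => by simp⟩

/-- Isometric embeddability of coded spaces; if `s` holds, then the embedding has to be onto. -/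
def Emb (s : Prop) (ρ ρ' : UltraCode L) : Prop :=
  ∃ f : ℕ → ℕ, (∀ i j, ρ' (f i) (f j) = ρ i j) ∧ (s → ∀ j, ∃ i, ρ' (f i) j = ⊥)

/-- Codes are pseudometrics, so surjectivity is only up to distance `⊥`. Any choice of preimages in
this sense is an inverse, since distances do not see such changes. -/
theorem Emb.symm {ρ ρ' : UltraCode L} (h : Emb True ρ ρ') : Emb True ρ' ρ := by
  obtain ⟨f, hf, hs⟩ := h
  choose g hg using hs trivial
  refine ⟨g, fun i j => ?_, fun _ j => ⟨f j, ?_⟩⟩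
  · rw [← hf]
    exact ρ'.congr (hg i) (hg j)
  · rw [← hf]
    exact hg _

theorem Emb.point_point (s : Prop) : Emb s (point : UltraCode L) point :=
  ⟨id, fun _ _ => rfl, fun _ _ => ⟨0, rfl⟩⟩

instance : MeasurableSpace (UltraCode L) :=
  ⨆ i : ℕ, ⨆ j : ℕ, MeasurableSpace.comap (fun ρ : UltraCode L => ρ i j) ⊤

theorem measurableSet_mem (i j : ℕ) (S : Set L) : MeasurableSet {ρ : UltraCode L | ρ i j ∈ S} := by
  have h : MeasurableSpace.comap (fun ρ : UltraCode L => ρ i j) ⊤ ≤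
      (inferInstance : MeasurableSpace (UltraCode L)) :=
    (le_iSup (fun j => MeasurableSpace.comap (fun ρ : UltraCode L => ρ i j) ⊤) j).trans
      (le_iSup (fun i => ⨆ j : ℕ, MeasurableSpace.comap (fun ρ : UltraCode L => ρ i j) ⊤) i)
  exact h _ ⟨S, trivial, rfl⟩

theorem measurable_of_entries {A : Type*} [MeasurableSpace A] [Countable L] {f : A → UltraCode L}
    (hf : ∀ i j l, MeasurableSet {a | f a i j = l}) : Measurable f := by
  refine Measurable.of_le_map (iSup_le fun i => iSup_le fun j => ?_)
  rintro _ ⟨S, -, rfl⟩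
  have e : f ⁻¹' ((fun ρ : UltraCode L => ρ i j) ⁻¹' S) = ⋃ l ∈ S, {a | f a i j = l} := by
    ext a
    simp
  change MeasurableSet (f ⁻¹' ((fun ρ : UltraCode L => ρ i j) ⁻¹' S))
  rw [e]
  exact MeasurableSet.biUnion S.to_countable fun l _ => hf i j l

/-- A set of codes which only depends on finitely many entries of the code is measurable. -/
theorem measurableSet_of_local [Countable L] {S : Set (UltraCode L)} (N : ℕ)
    (hS : ∀ ρ ρ' : UltraCode L, (∀ i ≤ N, ∀ j ≤ N, ρ i j = ρ' i j) → ρ ∈ S → ρ' ∈ S) :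
    MeasurableSet S := by
  let r : UltraCode L → (Fin (N + 1) × Fin (N + 1) → L) := fun ρ p => ρ p.1 p.2
  have e : S = ⋃ t ∈ r '' S, ⋂ p, {ρ : UltraCode L | ρ p.1 p.2 ∈ ({t p} : Set L)} := by
    ext ρ
    simp only [mem_iUnion, mem_iInter]
    constructor
    · exact fun h => ⟨r ρ, ⟨ρ, h, rfl⟩, fun p => rfl⟩
    · rintro ⟨_, ⟨ρ', h, rfl⟩, hρ⟩
      exact hS ρ' ρ (fun i hi j hj =>
        (hρ (⟨i, Nat.lt_succ_of_le hi⟩, ⟨j, Nat.lt_succ_of_le hj⟩)).symm) h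
  rw [e]
  exact MeasurableSet.biUnion (to_countable _) fun t _ =>
    MeasurableSet.iInter fun p => measurableSet_mem _ _ _

theorem measurable_of_local {L' : Type*} [LinearOrder L'] [OrderBot L'] [Countable L] [Countable L']
    {f : UltraCode L → UltraCode L'} (N : ℕ → ℕ → ℕ)
    (hf : ∀ (i j) (ρ ρ' : UltraCode L), (∀ k ≤ N i j, ∀ l ≤ N i j, ρ k l = ρ' k l) →
      f ρ i j = f ρ' i j) : Measurable f :=
  measurable_of_entries fun i j _ => measurableSet_of_local (N i j) fun ρ ρ' h hρ =>
    (hf i j ρ ρ' h).symm.trans hρ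

end Basic

/-! ### Change of distance set along an order isomorphism -/

section Map

variable {L L' : Type*} [LinearOrder L] [OrderBot L] [LinearOrder L'] [OrderBot L']

/-- The change of distances along an order isomorphism. -/
def map (e : L ≃o L') (ρ : UltraCode L) : UltraCode L' :=
  ⟨fun i j => e (ρ i j), fun i => by rw [ρ.self, e.map_bot], fun i j => by rw [ρ.symm i j],
    fun i j k => by rw [← e.monotone.map_max]; exact e.monotone (ρ.triangle i j k)⟩

theorem measurable_map [Countable L] [Countable L'] (e : L ≃o L') : Measurable (map e) :=
  measurable_of_local max fun i j ρ ρ' h => by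
    change e (ρ i j) = e (ρ' i j)
    rw [h i (le_max_left i j) j (le_max_right i j)]

theorem emb_map (e : L ≃o L') (s : Prop) (ρ ρ' : UltraCode L) :
    Emb s ρ ρ' ↔ Emb s (map e ρ) (map e ρ') := by
  refine exists_congr fun f => and_congr ?_ ?_
  · exact forall₂_congr fun i j => e.injective.eq_iff.symm
  · refine imp_congr_right fun _ => forall_congr' fun j => exists_congr fun i => ?_
    exact (map_eq_bot_iff e).symm

end Map

/-! ### Disjoint unions at distance `⊤` -/

section Sum

variable {L : Type*} [LinearOrder L] [OrderBot L]

/-- The disjoint union of a sequence of spaces, where points of different spaces have distance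
`⊤`. -/
def sum (x : ℕ → UltraCode L) : UltraCode (WithTop L) :=
  ⟨fun i j => if i.unpair.1 = j.unpair.1 then (x i.unpair.1 i.unpair.2 j.unpair.2 : WithTop L)
      else ⊤,
    fun i => by simp [self],
    fun i j => by
      by_cases h : i.unpair.1 = j.unpair.1
      · simp only [h, if_true]
        rw [symm]
      · simp [h, Ne.symm h],
    fun i j k => by
      by_cases h : i.unpair.1 = j.unpair.1 <;> by_cases h' : j.unpair.1 = k.unpair.1
      · simp only [h, h', if_true]
        exact_mod_cast triangle _ _ _ _
      · simp [h']
      · simp [h]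
      · simp [h, h']⟩

theorem sum_pair (x : ℕ → UltraCode L) (k i j : ℕ) :
    sum x (Nat.pair k i) (Nat.pair k j) = (x k i j : WithTop L) := by
  simp [sum]

theorem sum_eq_top_iff (x : ℕ → UltraCode L) (i j : ℕ) :
    sum x i j = ⊤ ↔ i.unpair.1 ≠ j.unpair.1 := by
  simp [sum]

theorem measurable_sum [Countable L] : Measurable (sum : (ℕ → UltraCode L) → _) := by
  refine measurable_of_entries fun i j l => ?_
  by_cases h : i.unpair.1 = j.unpair.1
  · have e : {x : ℕ → UltraCode L | sum x i j = l} = (fun x => x i.unpair.1) ⁻¹'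
        {ρ | ρ i.unpair.2 j.unpair.2 ∈ ((↑) : L → WithTop L) ⁻¹' {l}} := by
      ext x
      simp [sum, h]
    rw [e]
    exact measurable_pi_apply _ (measurableSet_mem _ _ _)
  · have e : {x : ℕ → UltraCode L | sum x i j = l} = {x | (⊤ : WithTop L) = l} := by
      ext x
      simp [sum, h]
    rw [e]
    exact MeasurableSet.const _

theorem emb_sum {s : Prop} {x y : ℕ → UltraCode L} {h : ℕ → ℕ} (hi : Function.Injective h)
    (hs : s → Function.Surjective h) (hxy : ∀ n, Emb s (x n) (y (h n))) :
    Emb s (sum x) (sum y) := by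
  choose g hg hgs using hxy
  refine ⟨fun i => Nat.pair (h i.unpair.1) (g i.unpair.1 i.unpair.2), fun i j => ?_, fun s j => ?_⟩
  · simp only [sum, Nat.unpair_pair, hi.eq_iff]
    split_ifs with e
    · rw [← e, hg]
    · rfl
  · obtain ⟨k, hk⟩ := hs s j.unpair.1
    have h1 := hgs k s
    rw [hk] at h1
    obtain ⟨i, hi⟩ := h1 j.unpair.2
    refine ⟨Nat.pair k i, ?_⟩
    simp [sum, hk, hi]

/-- Distance `⊤` occurs exactly between different summands, so an embedding carries each summand
into a single one and different summands into different ones. The point with index `0` of each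
summand serves to read off the target. -/
theorem exists_emb_of_emb_sum {s : Prop} {x y : ℕ → UltraCode L} (hxy : Emb s (sum x) (sum y)) :
    ∃ h : ℕ → ℕ, Function.Injective h ∧ ∀ n, Emb s (x n) (y (h n)) := by
  obtain ⟨f, hf, hs⟩ := hxy
  have hclass : ∀ i j, (f i).unpair.1 = (f j).unpair.1 ↔ i.unpair.1 = j.unpair.1 := by
    intro i j
    have := hf i j
    rw [← not_iff_not, ← ne_eq, ← ne_eq, ← sum_eq_top_iff y, ← sum_eq_top_iff x, this]
  have hpair : ∀ n i, f (Nat.pair n i) =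
      Nat.pair (f (Nat.pair n 0)).unpair.1 (f (Nat.pair n i)).unpair.2 := by
    intro n i
    have : (f (Nat.pair n 0)).unpair.1 = (f (Nat.pair n i)).unpair.1 :=
      (hclass _ _).2 (by simp)
    rw [this, Nat.pair_unpair]
  refine ⟨fun n => (f (Nat.pair n 0)).unpair.1, fun n m hnm => ?_, fun n => ?_⟩
  · simpa using (hclass _ _).1 hnm
  · refine ⟨fun i => (f (Nat.pair n i)).unpair.2, fun i j => ?_, fun s j => ?_⟩
    · have := hf (Nat.pair n i) (Nat.pair n j)
      rw [hpair n i, hpair n j, sum_pair, sum_pair] at this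
      simpa using this
    -- The preimage `k` lies in summand `n`, because its image lies in the summand that receives
    -- summand `n`.
    · obtain ⟨k, hk⟩ := hs s (Nat.pair (f (Nat.pair n 0)).unpair.1 j)
      have hk1 : (f k).unpair.1 = (f (Nat.pair n 0)).unpair.1 := by
        by_contra hne
        have := (sum_eq_top_iff y (f k) (Nat.pair (f (Nat.pair n 0)).unpair.1 j)).2 (by simpa using hne)
        rw [hk] at this
        exact bot_ne_top this
      have hk2 : k = Nat.pair n k.unpair.2 := by
        have := (hclass _ _).1 hk1
        rw [Nat.unpair_pair] at this
        conv_lhs => rw [← Nat.pair_unpair k, this]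
      refine ⟨k.unpair.2, ?_⟩
      rw [hk2, hpair, sum_pair] at hk
      exact_mod_cast hk

end Sum

end UltraCode

namespace UltraCode

/-! ### Making spaces have at least two points -/

section Thicken

variable {L : Type*} [LinearOrder L] [OrderBot L]

/-- A new point (with index `0`) is added at distance `t` from all points. -/
def addPoint (t : L) (ht : IsTop t) (ρ : UltraCode L) : UltraCode L :=
  ⟨fun i j => match i, j with
    | 0, 0 => ⊥
    | 0, _ + 1 => t
    | _ + 1, 0 => t
    | i + 1, j + 1 => ρ i j,
    fun i => by cases i <;> simp [self],
    fun i j => by cases i <;> cases j <;> simp [symm ρ],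
    fun i j k => by
      cases i <;> cases j <;> cases k <;> (simp [triangle ρ]; try exact ht _)⟩

/-- An embedding of the enlarged spaces may move the added point, but it can be repaired: the old
points sent to the added point are rerouted to the image of the added point. Both positions are at
distance `t` from the images of the other old points. -/
theorem emb_addPoint (t : L) (ht : IsTop t) (ht' : t ≠ ⊥) (s : Prop) (ρ ρ' : UltraCode L) :
    Emb s ρ ρ' ↔ Emb s (addPoint t ht ρ) (addPoint t ht ρ') := by
  constructor
  · rintro ⟨f, hf, hs⟩
    refine ⟨fun i => match i with
      | 0 => 0
      | i + 1 => f i + 1, fun i j => ?_, fun s j => ?_⟩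
    · cases i <;> cases j <;> simp [addPoint, hf]
    · cases j with
      | zero => exact ⟨0, rfl⟩
      | succ j =>
        obtain ⟨i, hi⟩ := hs s j
        exact ⟨i + 1, hi⟩
  · rintro ⟨f, hf, hs⟩
    have hz : ∀ j, addPoint t ht ρ' 0 j = ⊥ → j = 0 := by
      intro j h
      cases j with
      | zero => rfl
      | succ j => exact (ht' h).elim
    have hz' : ∀ j, addPoint t ht ρ' 0 j ≠ ⊥ → addPoint t ht ρ' 0 j = t := by
      intro j h
      cases j with
      | zero => exact (h rfl).elim
      | succ j => rfl
    have h0 : ∀ i, f (i + 1) = 0 → f 0 ≠ 0 := by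
      intro i hi h
      have := hf 0 (i + 1)
      rw [hi, h] at this
      exact ht' this.symm
    let G : ℕ → ℕ := fun i => if f (i + 1) = 0 then f 0 else f (i + 1)
    have hG : ∀ i, ∃ k, G i = k + 1 := by
      intro i
      refine Nat.exists_eq_succ_of_ne_zero ?_
      by_cases h : f (i + 1) = 0
      · simpa only [G, h, if_true] using h0 i h
      · simp [G, h]
    have hGd : ∀ i j, addPoint t ht ρ' (G i) (G j) = ρ i j := by
      have key : ∀ i j, f (i + 1) = 0 → f (j + 1) ≠ 0 →
          addPoint t ht ρ' (G i) (G j) = ρ i j := by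
        intro i j hi hj
        have e1 := hf (i + 1) (j + 1)
        have e2 := hf 0 (j + 1)
        rw [hi] at e1
        simp only [G, hi, hj, if_true, if_false]
        rw [e2]
        change t = ρ i j
        change _ = ρ i j at e1
        rw [← e1]
        refine (hz' _ fun h => hj (hz _ h)).symm
      intro i j
      by_cases hi : f (i + 1) = 0 <;> by_cases hj : f (j + 1) = 0
      · have e1 := hf (i + 1) (j + 1)
        rw [hi, hj, self] at e1
        simp only [G, hi, hj, if_true, self]
        exact e1
      · exact key i j hi hj
      · rw [symm, symm ρ]
        exact key j i hj hi
      · simp only [G, hi, hj, if_false]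
        exact hf _ _
    choose g hg using hG
    refine ⟨g, fun i j => ?_, fun s j => ?_⟩
    · have := hGd i j
      rw [hg, hg] at this
      exact this
    · obtain ⟨n, hn⟩ := hs s (j + 1)
      have hn0 : f n ≠ 0 := by
        intro h
        rw [h] at hn
        exact Nat.succ_ne_zero j (hz _ hn)
      -- If the preimage is the added point itself, then the target's added point is the image of
      -- some old point, which `G` reroutes to `f 0`.
      have : ∃ i, G i = f n := by
        cases n with
        | zero =>
          obtain ⟨m, hm⟩ := hs s 0
          rw [symm] at hm
          have hm := hz _ hm
          cases m with
          | zero => exact (hn0 hm).elim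
          | succ i => exact ⟨i, by simp [G, hm]⟩
        | succ i => exact ⟨i, by simp [G, hn0]⟩
      obtain ⟨i, hi⟩ := this
      refine ⟨i, ?_⟩
      rw [← hi, hg] at hn
      exact hn

/-- Each point `i` is replaced by two points `2 * i` and `2 * i + 1` at distance `t ⊥`, and the
nonzero distances are changed by `t`. -/
def double (t : L → L) (ht : StrictMono t) (ρ : UltraCode L) : UltraCode L :=
  ⟨fun i j => if ρ (i / 2) (j / 2) = ⊥ then (if i % 2 = j % 2 then ⊥ else t ⊥)
      else t (ρ (i / 2) (j / 2)),
    fun i => by simp [self],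
    fun i j => by simp only [symm ρ (i / 2), eq_comm (a := i % 2)],
    fun i j k => by
      have h := ρ.triangle (i / 2) (j / 2) (k / 2)
      have hm := ht.monotone (bot_le (a := ρ (j / 2) (k / 2)))
      have hm' := ht.monotone (bot_le (a := ρ (i / 2) (j / 2)))
      by_cases h1 : ρ (i / 2) (j / 2) = ⊥ <;> by_cases h2 : ρ (j / 2) (k / 2) = ⊥
      · rw [h1, h2, max_self, le_bot_iff] at h
        simp only [h, h1, h2, if_true]
        split_ifs <;> simp_all
      · rw [ρ.congr h1 (ρ.self (k / 2))]
        simp [h2]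
      · rw [← ρ.congr (ρ.self (i / 2)) h2]
        simp [h1]
      · simp only [h1, h2, if_false]
        have h3 := ht.monotone h
        rw [ht.monotone.map_max] at h3
        split_ifs
        · exact bot_le
        · exact hm.trans (le_max_right _ _)
        · exact h3⟩

theorem double_eq_bot (t : L → L) (ht : StrictMono t) (hb : t ⊥ ≠ ⊥) (ρ : UltraCode L) (i j : ℕ) :
    double t ht ρ i j = ⊥ ↔ ρ (i / 2) (j / 2) = ⊥ ∧ i % 2 = j % 2 := by
  have h : ∀ l, t l ≠ ⊥ := fun l h => hb (le_bot_iff.1 ((ht.monotone bot_le).trans_eq h))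
  simp only [double]
  split_ifs <;> simp_all

/-- The distances `> t ⊥` are those between points that come from different points of the original
space, so an isometric embedding recognizes twins. -/
theorem lt_double_iff (t : L → L) (ht : StrictMono t) (ρ : UltraCode L) (i j : ℕ) :
    t ⊥ < double t ht ρ i j ↔ ρ (i / 2) (j / 2) ≠ ⊥ := by
  simp only [double]
  split_ifs with h1 h2
  · simp [h1]
  · simp [h1]
  · simpa [h1] using ht (bot_lt_iff_ne_bot.2 h1)

theorem double_of_ne (t : L → L) (ht : StrictMono t) (ρ : UltraCode L) {i j : ℕ}
    (h : ρ (i / 2) (j / 2) ≠ ⊥) : double t ht ρ i j = t (ρ (i / 2) (j / 2)) := by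
  simp [double, h]

/-- An embedding of doubled spaces need not respect parity. But it respects being twins, up to
distance `⊥`, so halving indices gives a map of the original spaces, and injectivity of `t` recovers
the distances. -/
theorem emb_double (t : L → L) (ht : StrictMono t) (hb : t ⊥ ≠ ⊥) (s : Prop)
    (ρ ρ' : UltraCode L) : Emb s ρ ρ' ↔ Emb s (double t ht ρ) (double t ht ρ') := by
  have hdiv : ∀ i k, (2 * i + k % 2) / 2 = i := fun i k => by omega
  have hmod : ∀ i k, (2 * i + k % 2) % 2 = k % 2 := fun i k => by omega
  constructor
  · rintro ⟨f, hf, hs⟩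
    refine ⟨fun i => 2 * f (i / 2) + i % 2, fun i j => ?_, fun s j => ?_⟩
    · simp only [double, hdiv, hmod, hf]
    · obtain ⟨i, hi⟩ := hs s (j / 2)
      refine ⟨2 * i + j % 2, ?_⟩
      rw [double_eq_bot t ht hb]
      simp only [hdiv, hmod, and_true]
      exact hi
  · rintro ⟨f, hf, hs⟩
    have hz : ∀ i j, ρ' (f i / 2) (f j / 2) = ⊥ ↔ ρ (i / 2) (j / 2) = ⊥ := by
      intro i j
      rw [← not_iff_not, ← ne_eq, ← ne_eq, ← lt_double_iff t ht, ← lt_double_iff t ht, hf]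
    have hd : ∀ i, 2 * i / 2 = i := fun i => by omega
    refine ⟨fun i => f (2 * i) / 2, fun i j => ?_, fun s j => ?_⟩
    · have h1 := hz (2 * i) (2 * j)
      rw [hd, hd] at h1
      by_cases h : ρ i j = ⊥
      · rw [h]
        exact h1.2 h
      · have h2 := hf (2 * i) (2 * j)
        rw [double_of_ne t ht _ (fun h' => h (h1.1 h')), double_of_ne t ht _ (by rwa [hd, hd]),
          ht.injective.eq_iff, hd, hd] at h2
        exact h2
    · obtain ⟨n, hn⟩ := hs s (2 * j)
      rw [double_eq_bot t ht hb, hd] at hn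
      refine ⟨n / 2, ?_⟩
      rw [← hn.1]
      refine ρ'.congr ((hz _ _).2 ?_) (ρ'.self j)
      rw [hd]
      exact ρ.self _

/-- In a well-order with at least two elements, codes can be changed in such a way that the spaces
have at least two points. -/
theorem exists_thicken [Countable L] [Nontrivial L] [WellFoundedLT L] :
    ∃ φ : UltraCode L → UltraCode L, Measurable φ ∧
      (∀ s ρ ρ', Emb s ρ ρ' ↔ Emb s (φ ρ) (φ ρ')) ∧ ∀ s ρ, ¬ Emb s (φ ρ) point := by
  -- A greatest element can serve as distance to a new point. Without one, no distance is large
  -- enough for that, but the successor is strictly monotone and shifting by it frees the value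
  -- `succ ⊥` for twins.
  by_cases h : ∃ t : L, IsTop t
  · obtain ⟨t, ht⟩ := h
    have ht' : t ≠ ⊥ := by
      rintro rfl
      obtain ⟨l, hl⟩ := exists_ne (⊥ : L)
      exact hl (le_bot_iff.1 (ht l))
    refine ⟨addPoint t ht, measurable_of_local max fun i j ρ ρ' h => ?_, emb_addPoint t ht ht', ?_⟩
    · cases i <;> cases j
      · rfl
      · rfl
      · rfl
      · exact h _ (by omega) _ (by omega)
    · rintro s ρ ⟨f, hf, -⟩
      exact ht' (hf 0 1).symm
  · have : NoMaxOrder L := by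
      refine ⟨fun a => ?_⟩
      by_contra! hcon
      exact h ⟨a, hcon⟩
    let : SuccOrder L := SuccOrder.ofLinearWellFoundedLT L
    have hb : Order.succ (⊥ : L) ≠ ⊥ := (Order.lt_succ _).ne'
    refine ⟨double Order.succ Order.succ_strictMono,
      measurable_of_local max fun i j ρ ρ' h => ?_, emb_double _ _ hb, ?_⟩
    · simp only [double]
      rw [h _ (by omega) _ (by omega)]
    · rintro s ρ ⟨f, hf, -⟩
      have := (double_eq_bot Order.succ Order.succ_strictMono hb ρ 0 1).1 (hf 0 1).symm
      simp at this

end Thicken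

/-! ### Decomposition into pieces of diameter less than `⊤` -/

section Piece

variable {L : Type*} [LinearOrder L] [OrderBot L]

/-- The map onto the piece of `n`, i.e. the set of points at distance less than `⊤` from `n`. -/
noncomputable def toPiece (σ : UltraCode (WithTop L)) (n i : ℕ) : ℕ :=
  open Classical in if σ n i < ⊤ then i else n

/-- `n` is the least index of its piece. -/
def IsLeast (σ : UltraCode (WithTop L)) (n : ℕ) : Prop := ∀ k < n, σ n k = ⊤

variable (σ : UltraCode (WithTop L))

theorem lt_top_trans {i j k : ℕ} (h : σ i j < ⊤) (h' : σ j k < ⊤) : σ i k < ⊤ :=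
  (σ.triangle i j k).trans_lt (max_lt h h')

theorem toPiece_lt_top (n i : ℕ) : σ n (σ.toPiece n i) < ⊤ := by
  unfold toPiece
  split_ifs with h
  · exact h
  · rw [self]
    exact bot_lt_top

theorem toPiece_of_lt {n i : ℕ} (h : σ n i < ⊤) : σ.toPiece n i = i := if_pos h

theorem dist_toPiece_lt_top (n i j : ℕ) : σ (σ.toPiece n i) (σ.toPiece n j) < ⊤ :=
  σ.lt_top_trans (by rw [symm]; exact σ.toPiece_lt_top n i) (σ.toPiece_lt_top n j)

/-- Least indices are representatives of the pieces, unique by `IsLeast.eq_of_lt`. Whether `n` is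
one depends only on finitely many entries of the code. -/
theorem exists_isLeast (i : ℕ) : ∃ n, σ.IsLeast n ∧ σ n i < ⊤ := by
  classical
  have h : ∃ n, σ n i < ⊤ := ⟨i, by rw [self]; exact bot_lt_top⟩
  refine ⟨Nat.find h, fun k hk => ?_, Nat.find_spec h⟩
  by_contra hne
  refine Nat.find_min h hk (σ.lt_top_trans ?_ (Nat.find_spec h))
  rw [symm]
  exact lt_top_iff_ne_top.2 hne

variable {σ} in
theorem IsLeast.eq_of_lt {n m : ℕ} (hn : σ.IsLeast n) (hm : σ.IsLeast m) (h : σ n m < ⊤) :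
    n = m := by
  rcases lt_trichotomy n m with h' | h' | h'
  · have := hm n h'
    rw [symm] at this
    exact (h.ne this).elim
  · exact h'
  · exact (h.ne (hn m h')).elim

/-- The piece of `n`, as a space with smaller distances. -/
noncomputable def piece (n : ℕ) : UltraCode L :=
  ⟨fun i j => (σ (σ.toPiece n i) (σ.toPiece n j)).untop (σ.dist_toPiece_lt_top n i j).ne,
    fun i => by
      rw [WithTop.untop_eq_iff, self]
      rfl,
    fun i j => by simp only [symm σ (σ.toPiece n i)],
    fun i j k => by
      rw [← WithTop.coe_le_coe, WithTop.coe_max, WithTop.coe_untop, WithTop.coe_untop,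
        WithTop.coe_untop]
      exact σ.triangle _ _ _⟩

theorem coe_piece (n i j : ℕ) :
    (σ.piece n i j : WithTop L) = σ (σ.toPiece n i) (σ.toPiece n j) :=
  WithTop.coe_untop _ _

theorem measurable_piece [Countable L] (n : ℕ) :
    Measurable fun σ : UltraCode (WithTop L) => σ.piece n := by
  refine measurable_of_local (fun i j => max n (max i j)) fun i j σ σ' h => ?_
  have e : ∀ k ≤ max n (max i j), σ.toPiece n k = σ'.toPiece n k := fun k hk => by
    unfold toPiece
    rw [h n (le_max_left _ _) k hk]
  have e' : ∀ k ≤ max n (max i j), σ.toPiece n k ≤ max n (max i j) := fun k hk => by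
    unfold toPiece
    split_ifs
    · exact hk
    · exact le_max_left _ _
  have hi : i ≤ max n (max i j) := by omega
  have hj : j ≤ max n (max i j) := by omega
  rw [← WithTop.coe_inj, coe_piece, coe_piece, ← e i hi, ← e j hj]
  exact h _ (e' i hi) _ (e' j hj)

theorem measurableSet_isLeast [Countable L] (n : ℕ) :
    MeasurableSet {σ : UltraCode (WithTop L) | σ.IsLeast n} :=
  measurableSet_of_local n fun _ _ h hρ k hk => (h n le_rfl k hk.le).symm.trans (hρ k hk)

/-- Since `f` preserves both `< ⊤` and `= ⊤`, it maps pieces into pieces and separates different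
ones. If `f` is onto, whatever hits the piece containing `f n` comes from the piece of `n`. -/
theorem exists_emb_piece {s : Prop} {σ σ' : UltraCode (WithTop L)} (h : Emb s σ σ') :
    ∃ g : {n // σ.IsLeast n} → {n // σ'.IsLeast n}, Function.Injective g ∧
      ∀ n : {n // σ.IsLeast n}, Emb s (σ.piece n) (σ'.piece (g n)) := by
  obtain ⟨f, hf, hs⟩ := h
  choose c hc hcl using σ'.exists_isLeast
  have hin : ∀ n i, σ' (c (f n)) (f (σ.toPiece n i)) < ⊤ := fun n i =>
    σ'.lt_top_trans (hcl _) (by rw [hf]; exact σ.toPiece_lt_top n i)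
  refine ⟨fun n => ⟨c (f n), hc _⟩, fun n m hnm => ?_, fun n => ⟨fun i => f (σ.toPiece n i), ?_, ?_⟩⟩
  · have hnm : c (f n) = c (f m) := congrArg Subtype.val hnm
    refine Subtype.ext (n.2.eq_of_lt m.2 ?_)
    rw [← hf]
    refine σ'.lt_top_trans (j := c (f n)) ?_ ?_
    · rw [symm]; exact hcl _
    · rw [hnm]; exact hcl _
  · intro i j
    rw [← WithTop.coe_inj, coe_piece, coe_piece, σ'.toPiece_of_lt (hin _ _),
      σ'.toPiece_of_lt (hin _ _), hf]
  · intro s j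
    obtain ⟨i, hi⟩ := hs s (σ'.toPiece (c (f n)) j)
    refine ⟨i, ?_⟩
    have h1 : σ n i < ⊤ := by
      rw [← hf]
      refine σ'.lt_top_trans (j := c (f n)) (by rw [symm]; exact hcl _) ?_
      refine σ'.lt_top_trans (σ'.toPiece_lt_top (c (f n)) j) ?_
      rw [symm, hi]
      exact bot_lt_top
    rw [← WithTop.coe_inj, coe_piece, σ'.toPiece_of_lt (hin _ _), σ.toPiece_of_lt h1, hi]
    rfl

/-- Embeddings of the pieces glue: points of different pieces are at distance `⊤`, and so are their
images because `g` is injective. -/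
theorem emb_of_emb_piece {s : Prop} {σ σ' : UltraCode (WithTop L)}
    {g : {n // σ.IsLeast n} → {n // σ'.IsLeast n}} (hg : Function.Injective g)
    (hgs : s → Function.Surjective g) (h : ∀ n : {n // σ.IsLeast n}, Emb s (σ.piece n) (σ'.piece (g n))) :
    Emb s σ σ' := by
  choose f hf hs using h
  have hex : ∀ i, ∃ n : {n // σ.IsLeast n}, σ n i < ⊤ := fun i => by
    obtain ⟨n, hn, h⟩ := σ.exists_isLeast i
    exact ⟨⟨n, hn⟩, h⟩
  choose c hc using hex
  have hcu : ∀ (n : {n // σ.IsLeast n}) i, σ n i < ⊤ → c i = n := fun n i h =>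
    Subtype.ext ((c i).2.eq_of_lt n.2 (σ.lt_top_trans (hc i) (by rwa [symm])))
  refine ⟨fun i => σ'.toPiece (g (c i)) (f (c i) i), fun i j => ?_, fun s j => ?_⟩
  · by_cases hij : c i = c j
    · have hj := hc j
      rw [← hij] at hj
      simp only [← hij]
      rw [← coe_piece, hf, coe_piece, σ.toPiece_of_lt (hc i), σ.toPiece_of_lt hj]
    · have h1 : ¬ σ i j < ⊤ := fun h =>
        hij (hcu (c j) i (σ.lt_top_trans (hc j) (by rwa [symm])))
      have h2 : ¬ σ' (σ'.toPiece (g (c i)) (f (c i) i)) (σ'.toPiece (g (c j)) (f (c j) j)) < ⊤ := by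
        intro h
        refine hij (hg (Subtype.ext ((g (c i)).2.eq_of_lt (g (c j)).2 ?_)))
        refine σ'.lt_top_trans (σ'.toPiece_lt_top _ _) (σ'.lt_top_trans h ?_)
        rw [symm]
        exact σ'.toPiece_lt_top _ _
      rw [not_lt_top_iff] at h1 h2
      rw [h1, h2]
  · obtain ⟨n', hn', hj⟩ := σ'.exists_isLeast j
    obtain ⟨n, hn⟩ := hgs s ⟨n', hn'⟩
    obtain ⟨i, hi⟩ := hs n s j
    have hj : σ' (g n) j < ⊤ := by rwa [hn]
    refine ⟨σ.toPiece n i, ?_⟩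
    have hcn := hcu n _ (σ.toPiece_lt_top n i)
    simp only [hcn]
    -- In the piece of `n`, the indices `i` and `toPiece n i` name the same point, and the latter
    -- really belongs to the piece inside `σ`.
    have e : σ.piece n (σ.toPiece n i) i = ⊥ := by
      rw [← WithTop.coe_inj, coe_piece, σ.toPiece_of_lt (σ.toPiece_lt_top n i), self]
      rfl
    rw [← hf] at e
    have e2 := (σ'.piece (g n)).congr e ((σ'.piece (g n)).self j)
    rw [hi, ← WithTop.coe_inj, coe_piece, σ'.toPiece_of_lt hj] at e2
    exact e2

end Piece

/-! ### Correspondence between spaces over `WithTop L` and sequences of spaces over `L` -/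

section Jump

variable {L : Type*} [LinearOrder L] [OrderBot L]

open Classical in
/-- The sequence of the pieces of `σ`, changed by `φ`, with infinitely many one-point spaces
added. -/
noncomputable def pieces (φ : UltraCode L → UltraCode L) (σ : UltraCode (WithTop L)) (k : ℕ) : UltraCode L :=
  match Equiv.natSumNatEquivNat.symm k with
  | .inl n => if σ.IsLeast n then φ (σ.piece n) else point
  | .inr _ => point

theorem measurable_pieces [Countable L] {φ : UltraCode L → UltraCode L} (hφ : Measurable φ) :
    Measurable (pieces φ) := by
  classical
  refine measurable_pi_iff.2 fun k => ?_
  unfold pieces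
  rcases Equiv.natSumNatEquivNat.symm k with n | n
  · exact Measurable.ite (measurableSet_isLeast n) (hφ.comp (measurable_piece n)) measurable_const
  · exact measurable_const

variable {φ : UltraCode L → UltraCode L} {s : Prop} {σ σ' : UltraCode (WithTop L)}

theorem pieces_inl {n : ℕ} (h : σ.IsLeast n) :
    pieces φ σ (Equiv.natSumNatEquivNat (.inl n)) = φ (σ.piece n) := by
  simp [pieces, h]

theorem pieces_inl_of_not {n : ℕ} (h : ¬ σ.IsLeast n) :
    pieces φ σ (Equiv.natSumNatEquivNat (.inl n)) = point := by
  simp only [pieces, Equiv.symm_apply_apply, h, if_false]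

theorem pieces_inr (n : ℕ) : pieces φ σ (Equiv.natSumNatEquivNat (.inr n)) = point := by
  simp only [pieces, Equiv.symm_apply_apply]

theorem pieces_eq_point {k : ℕ}
    (h : ∀ n, σ.IsLeast n → k ≠ Equiv.natSumNatEquivNat (.inl n)) : pieces φ σ k = point := by
  obtain ⟨i, rfl⟩ := Equiv.natSumNatEquivNat.surjective k
  rcases i with n | n
  · exact pieces_inl_of_not fun hn => h n hn rfl
  · exact pieces_inr n

/-- Pieces follow the injection between pieces, while all padding, including the `inl` slots without
a piece, goes to `inr` slots. These always hold one-point spaces, so there is room for it and no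
collision with pieces. -/
theorem injJump_pieces
    (hφ : ∀ s ρ ρ', Emb s ρ ρ' ↔ Emb s (φ ρ) (φ ρ'))
    (h : Emb s σ σ') : injJump (Emb s) (pieces φ σ) (pieces φ σ') := by
  classical
  obtain ⟨g, hg, hgp⟩ := exists_emb_piece h
  let e := Equiv.natSumNatEquivNat
  let f : ℕ ⊕ ℕ → ℕ ⊕ ℕ := fun i => match i with
    | .inl n => if hn : σ.IsLeast n then .inl (g ⟨n, hn⟩) else .inr (e (.inl n))
    | .inr n => .inr (e (.inr n))
  have hf : Function.Injective f := by
    rintro (n | n) (m | m) hnm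
    · by_cases hn : σ.IsLeast n <;> by_cases hm : σ.IsLeast m <;> simp [f, hn, hm] at hnm
      · have := hg (Subtype.ext hnm)
        simpa using this
      · simpa using hnm
    · by_cases hn : σ.IsLeast n <;> simp [f, hn] at hnm
    · by_cases hm : σ.IsLeast m <;> simp [f, hm] at hnm
    · simpa [f] using hnm
  refine ⟨fun k => e (f (e.symm k)), e.injective.comp (hf.comp e.symm.injective), fun k => ?_⟩
  obtain ⟨i, rfl⟩ := e.surjective k
  simp only [e.symm_apply_apply]
  rcases i with n | n
  · by_cases hn : σ.IsLeast n
    · have e1 : f (.inl n) = .inl (g ⟨n, hn⟩) := by simp [f, hn]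
      rw [e1, pieces_inl hn, pieces_inl (g ⟨n, hn⟩).2, ← hφ]
      exact hgp ⟨n, hn⟩
    · have e1 : f (.inl n) = .inr (e (.inl n)) := by simp [f, hn]
      rw [e1, pieces_inl_of_not hn, pieces_inr]
      exact Emb.point_point s
  · have e1 : f (.inr n) = .inr (e (.inr n)) := rfl
    rw [e1, pieces_inr, pieces_inr]
    exact Emb.point_point s

/-- A thickened piece does not embed into a point, so the injection sends slots of pieces to slots
of pieces, and `hφ` removes the thickening. -/
theorem exists_of_injJump_pieces
    (hφ : ∀ s ρ ρ', Emb s ρ ρ' ↔ Emb s (φ ρ) (φ ρ'))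
    (hφ' : ∀ s ρ, ¬ Emb s (φ ρ) point)
    (h : injJump (Emb s) (pieces φ σ) (pieces φ σ')) :
    ∃ g : {n // σ.IsLeast n} → {n // σ'.IsLeast n}, Function.Injective g ∧
      ∀ n : {n // σ.IsLeast n}, Emb s (σ.piece n) (σ'.piece (g n)) := by
  obtain ⟨f, hf, hfe⟩ := h
  let e := Equiv.natSumNatEquivNat
  have key : ∀ n : {n // σ.IsLeast n}, ∃ m : {n // σ'.IsLeast n}, f (e (.inl n)) = e (.inl m) := by
    intro n
    by_contra! hcon
    have := hfe (e (.inl n))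
    rw [pieces_inl n.2, pieces_eq_point (σ := σ') fun m hm => hcon ⟨m, hm⟩] at this
    exact hφ' _ _ this
  choose g hg using key
  refine ⟨g, fun n m hnm => ?_, fun n => ?_⟩
  · have := hg n
    rw [hnm, ← hg m] at this
    simpa [Subtype.ext_iff] using hf this
  · have := hfe (e (.inl n))
    rwa [hg, pieces_inl n.2, pieces_inl (g n).2, ← hφ] at this

theorem emb_false_iff_injJump_pieces
    (hφ : ∀ s ρ ρ', Emb s ρ ρ' ↔ Emb s (φ ρ) (φ ρ'))
    (hφ' : ∀ s ρ, ¬ Emb s (φ ρ) point) :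
    Emb False σ σ' ↔ injJump (Emb False) (pieces φ σ) (pieces φ σ') := by
  refine ⟨injJump_pieces hφ, fun h => ?_⟩
  obtain ⟨g, hg, hgp⟩ := exists_of_injJump_pieces hφ hφ' h
  exact emb_of_emb_piece hg False.elim hgp

/-- The Schröder–Bernstein bijection matches each piece either along the first injection or
backwards along the second. As isometry is symmetric, matched pieces are isometric in both cases. -/
theorem emb_true_iff_assocEquiv_pieces
    (hφ : ∀ s ρ ρ', Emb s ρ ρ' ↔ Emb s (φ ρ) (φ ρ'))
    (hφ' : ∀ s ρ, ¬ Emb s (φ ρ) point) :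
    Emb True σ σ' ↔ assocEquiv (injJump (Emb True)) (pieces φ σ) (pieces φ σ') := by
  refine ⟨fun h => ⟨injJump_pieces hφ h, injJump_pieces hφ h.symm⟩, fun h => ?_⟩
  obtain ⟨g, hg, hgp⟩ := exists_of_injJump_pieces hφ hφ' h.1
  obtain ⟨g', hg', hgp'⟩ := exists_of_injJump_pieces hφ hφ' h.2
  obtain ⟨k, hk, hkp⟩ := Function.Embedding.schroeder_bernstein_of_rel hg hg'
    (fun n m => Emb True (σ.piece n) (σ'.piece m)) hgp fun m => (hgp' m).symm
  exact emb_of_emb_piece hk.1 (fun _ => hk.2) hkp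

theorem injJump_iff_emb_false_sum {x y : ℕ → UltraCode L} :
    injJump (Emb False) x y ↔ Emb False (sum x) (sum y) :=
  ⟨fun ⟨_, hf, h⟩ => emb_sum hf False.elim h, exists_emb_of_emb_sum⟩

theorem assocEquiv_iff_emb_true_sum {x y : ℕ → UltraCode L} :
    assocEquiv (injJump (Emb True)) x y ↔ Emb True (sum x) (sum y) := by
  refine ⟨fun ⟨⟨f, hf, h⟩, ⟨g, hg, h'⟩⟩ => ?_, fun h =>
    ⟨exists_emb_of_emb_sum h, exists_emb_of_emb_sum h.symm⟩⟩
  obtain ⟨k, hk, hkp⟩ := Function.Embedding.schroeder_bernstein_of_rel hf hg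
    (fun n m => Emb True (x n) (y m)) h fun m => (h' m).symm
  exact emb_sum hk.1 (fun _ => hk.2) hkp

end Jump

end UltraCode

/-! ## Codes for closed subspaces of the Urysohn space -/

section Coding

variable {D : Set ℝ≥0}

theorem coe_bot_of_zero_mem [OrderBot D] (h0 : 0 ∈ D) : ((⊥ : D) : ℝ≥0) = 0 :=
  le_antisymm (show (⊥ : D) ≤ ⟨0, h0⟩ from bot_le) zero_le

/-- `ρ` is the distance matrix of an enumeration of `U`. -/
def IsCodeOf [OrderBot D] (ρ : UltraCode D) (U : UltraPolish D) : Prop :=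
  ∃ p : ℕ → U.1.1, Function.Surjective p ∧ ∀ i j, nndist (p i) (p j) = ρ i j

section

variable [OrderBot D] {ρ ρ' : UltraCode D} {U V : UltraPolish D}

theorem embedsOn_iff_emb (hU : IsCodeOf ρ U) (hV : IsCodeOf ρ' V) :
    embedsOn D U V ↔ UltraCode.Emb False ρ ρ' := by
  obtain ⟨p, hp, hpd⟩ := hU
  obtain ⟨p', hp', hpd'⟩ := hV
  constructor
  · rintro ⟨φ, hφ⟩
    choose f hf using fun i => hp' (φ (p i))
    refine ⟨f, fun i j => ?_, False.elim⟩
    rw [← Subtype.coe_inj, ← hpd', ← hpd, hf, hf, hφ.nndist_eq]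
  · rintro ⟨f, hf, -⟩
    choose r hr using hp
    refine ⟨fun x => p' (f (r x)), Isometry.of_nndist_eq fun x y => ?_⟩
    rw [hpd', hf, ← hpd, hr, hr]

theorem isomOn_iff_emb (h0 : 0 ∈ D) (hU : IsCodeOf ρ U) (hV : IsCodeOf ρ' V) :
    isomOn D U V ↔ UltraCode.Emb True ρ ρ' := by
  obtain ⟨p, hp, hpd⟩ := hU
  obtain ⟨p', hp', hpd'⟩ := hV
  have hz' : ∀ i j, ρ' i j = ⊥ ↔ p' i = p' j := fun i j => by
    rw [← nndist_eq_zero (x := p' i), hpd', ← coe_bot_of_zero_mem h0, Subtype.coe_inj]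
  have hz : ∀ i j, ρ i j = ⊥ ↔ p i = p j := fun i j => by
    rw [← nndist_eq_zero (x := p i), hpd, ← coe_bot_of_zero_mem h0, Subtype.coe_inj]
  constructor
  · rintro ⟨φ⟩
    choose f hf using fun i => hp' (φ (p i))
    refine ⟨f, fun i j => ?_, fun _ j => ?_⟩
    · rw [← Subtype.coe_inj, ← hpd', ← hpd, hf, hf, φ.isometry.nndist_eq]
    · obtain ⟨i, hi⟩ := hp (φ.symm (p' j))
      refine ⟨i, ?_⟩
      rw [hz', hf, hi, φ.apply_symm_apply]
  · rintro ⟨f, hf, hs⟩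
    choose r hr using hp
    have hφ : Isometry fun x => p' (f (r x)) := Isometry.of_nndist_eq fun x y => by
      rw [hpd', hf, ← hpd, hr, hr]
    have hsurj : Function.Surjective fun x => p' (f (r x)) := by
      intro y
      obtain ⟨j, rfl⟩ := hp' y
      obtain ⟨i, hi⟩ := hs trivial j
      refine ⟨p i, ?_⟩
      rw [← (hz' _ _).1 hi]
      change p' (f (r (p i))) = _
      rw [← hz', hf, hz, hr]
    exact ⟨⟨Equiv.ofBijective _ ⟨hφ.injective, hsurj⟩, hφ⟩⟩

end

/-- The least nonzero distance is such a gap. Only here is well-foundedness used to make the spaces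
uniformly discrete. -/
theorem exists_gap [WellFoundedLT D] : ∃ δ : ℝ≥0, 0 < δ ∧ ∀ d ∈ D, d < δ → d = 0 := by
  by_cases h : ∃ d : D, (d : ℝ≥0) ≠ 0
  · obtain ⟨m, hm, hmin⟩ := WellFounded.has_min (wellFounded_lt (α := D))
      {d | (d : ℝ≥0) ≠ 0} h
    refine ⟨m, pos_iff_ne_zero.2 hm, fun d hd hlt => ?_⟩
    by_contra hne
    exact hmin ⟨d, hd⟩ hne hlt
  · push Not at h
    exact ⟨1, one_pos, fun d hd _ => h ⟨d, hd⟩⟩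

/-- A point within the gap of a term of a dense sequence equals that term, so measurable dense
sequences enumerate the whole space, and their mutual distances are measurable. -/
theorem exists_measurable_code [OrderBot D] [WellFoundedLT D] [Countable D] (h0 : 0 ∈ D) :
    ∃ c : UltraPolish D → UltraCode D, Measurable c ∧ ∀ U, IsCodeOf (c U) U := by
  obtain ⟨s, hs, hsm, hsd⟩ := exists_measurable_dense_seq (Y := UrysohnSpace)
  obtain ⟨δ, hδ, hgap⟩ := exists_gap (D := D)
  have hcode : ∀ U : UltraPolish D, ∃ ρ : UltraCode D,
      ∀ i j, (ρ i j : ℝ≥0) = nndist (s i U.1) (s j U.1) := fun U => by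
    have hu := U.2.1
    refine ⟨⟨fun i j => ⟨nndist (s i U.1) (s j U.1), U.2.2 _ (hsm _ _) _ (hsm _ _)⟩,
      fun i => ?_, fun i j => ?_, fun i j k => ?_⟩, fun i j => rfl⟩
    · rw [← Subtype.coe_inj, coe_bot_of_zero_mem h0]
      exact nndist_self _
    · simp only [nndist_comm (s i U.1)]
    · have := hu.dist_triangle_max ⟨s i U.1, hsm _ _⟩ ⟨s j U.1, hsm _ _⟩ ⟨s k U.1, hsm _ _⟩
      rcases le_max_iff.1 this with h | h
      · exact le_max_of_le_left h
      · exact le_max_of_le_right h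
  choose c hc using hcode
  refine ⟨c, UltraCode.measurable_of_entries fun i j l => ?_, fun U =>
    ⟨fun i => ⟨s i U.1, hsm _ _⟩, fun x => ?_, fun i j => (hc U i j).symm⟩⟩
  · have e : {U | c U i j = l} = (fun U : UltraPolish D => nndist (s i U.1) (s j U.1)) ⁻¹' {l.1} := by
      ext U
      simp only [mem_ofPred_eq, mem_preimage, mem_singleton_iff, ← hc, Subtype.coe_inj]
    rw [e]
    exact ((hs i).nndist (hs j)).comp measurable_subtype_coe (measurableSet_singleton _)
  · obtain ⟨n, hn⟩ := hsd U.1 x x.2 δ hδ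
    refine ⟨n, Subtype.ext ?_⟩
    have h1 : nndist x.1 (s n U.1) = 0 := hgap _ (U.2.2 _ x.2 _ (hsm _ _)) hn
    exact (nndist_eq_zero.1 h1).symm

/-- Two terms within `δ / 2` of a limit point coincide. If the limit point were not in the range,
the second could be taken strictly closer than the first. -/
theorem isClosed_range_of_gap {Y : Type*} [MetricSpace Y] {u : ℕ → Y} {δ : ℝ≥0} (hδ : 0 < δ)
    (h : ∀ i j, nndist (u i) (u j) < δ → nndist (u i) (u j) = 0) : IsClosed (range u) := by
  have hδ' : (0 : ℝ) < δ := hδ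
  refine isClosed_of_closure_subset fun x hx => ?_
  rw [Metric.mem_closure_range_iff] at hx
  obtain ⟨n, hn⟩ := hx (δ / 2) (half_pos hδ')
  by_contra hne
  have hpos : 0 < dist x (u n) := dist_pos.2 fun h => hne ⟨n, h.symm⟩
  obtain ⟨m, hm⟩ := hx _ (lt_min hpos (half_pos hδ'))
  have hnm : nndist (u n) (u m) < δ := by
    have h1 := dist_triangle (u n) x (u m)
    rw [dist_comm (u n) x] at h1
    have h2 := hm.trans_le (min_le_right _ _)
    change dist (u n) (u m) < δ
    linarith
  have := nndist_eq_zero.1 (h n m hnm)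
  rw [this] at hm
  exact (hm.trans_le (min_le_left _ _)).false

/-- The code is embedded measurably into the Urysohn space. By the gap no closure is needed, so an
open set meets the image exactly when it contains some `u i ρ`, which is a Borel condition. -/
theorem exists_measurable_space [OrderBot D] [WellFoundedLT D] (h0 : 0 ∈ D) :
    ∃ g : UltraCode D → UltraPolish D, Measurable g ∧ ∀ ρ, IsCodeOf ρ (g ρ) := by
  obtain ⟨δ, hδ, hgap⟩ := exists_gap (D := D)
  have htri : ∀ (ρ : UltraCode D) (i j k : ℕ),
      (ρ i k : ℝ≥0) ≤ max (ρ i j : ℝ≥0) (ρ j k) := fun ρ i j k => by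
    rcases le_max_iff.1 (ρ.triangle i j k) with h | h
    · exact le_max_of_le_left h
    · exact le_max_of_le_right h
  let d : UltraCode D → PseudoMetric ℕ ℝ := fun ρ =>
    { toFun := fun i j => ((ρ i j : ℝ≥0) : ℝ)
      refl' := fun i => by rw [ρ.self, coe_bot_of_zero_mem h0, NNReal.coe_zero]
      symm' := fun i j => by rw [ρ.symm]
      triangle' := fun i j k => by
        have := (htri ρ i j k).trans (max_le (le_add_of_nonneg_right zero_le)
          (le_add_of_nonneg_left zero_le))
        exact_mod_cast this }
  obtain ⟨u, hu, hud⟩ := UrysohnSpace.exists_measurable_embedding d fun i j S _ =>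
    UltraCode.measurableSet_mem i j {l : D | ((l : ℝ≥0) : ℝ) ∈ S}
  have hnn : ∀ ρ i j, nndist (u i ρ) (u j ρ) = ρ i j := fun ρ i j => NNReal.eq (hud ρ i j)
  let F : UltraCode D → ClosedSubsets UrysohnSpace := fun ρ =>
    ⟨range fun i => u i ρ, isClosed_range_of_gap hδ fun i j h => by
      rw [hnn] at h ⊢
      exact hgap _ (ρ i j).2 h, range_nonempty _⟩
  have hF : ∀ ρ, F ρ ∈ UltraPolish D := fun ρ => by
    refine ⟨⟨?_⟩, ?_⟩
    · rintro ⟨_, i, rfl⟩ ⟨_, j, rfl⟩ ⟨_, k, rfl⟩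
      change dist (u i ρ) (u k ρ) ≤ max (dist (u i ρ) (u j ρ)) (dist (u j ρ) (u k ρ))
      have := htri ρ i j k
      rw [← hnn, ← hnn, ← hnn] at this
      exact_mod_cast this
    · rintro _ ⟨i, rfl⟩ _ ⟨j, rfl⟩
      rw [hnn]
      exact (ρ i j).2
  refine ⟨fun ρ => ⟨F ρ, hF ρ⟩, Measurable.subtype_mk (measurable_generateFrom ?_), fun ρ =>
    ⟨fun i => ⟨u i ρ, i, rfl⟩, ?_, fun i j => hnn ρ i j⟩⟩
  · rintro _ ⟨V, hV, rfl⟩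
    have e : F ⁻¹' {F | (F.1 ∩ V).Nonempty} = ⋃ i, u i ⁻¹' V := by
      ext ρ
      simp only [mem_preimage, mem_iUnion]
      constructor
      · rintro ⟨_, ⟨i, rfl⟩, hi⟩
        exact ⟨i, hi⟩
      · rintro ⟨i, hi⟩
        exact ⟨_, ⟨i, rfl⟩, hi⟩
    rw [e]
    exact MeasurableSet.iUnion fun i => hu i hV.measurableSet
  · rintro ⟨_, i, rfl⟩
    exact ⟨i, rfl⟩

end Coding

/-! ## Borel reducibility -/

section Reducibility

variable {X Y Z : Type*} [MeasurableSpace X] [MeasurableSpace Y] [MeasurableSpace Z]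
  {R : X → X → Prop} {S : Y → Y → Prop} {T : Z → Z → Prop}

theorem BorelReducible.trans (h : BorelReducible R S) (h' : BorelReducible S T) :
    BorelReducible R T := by
  obtain ⟨f, hf, hfR⟩ := h
  obtain ⟨g, hg, hgS⟩ := h'
  exact ⟨g ∘ f, hg.comp hf, fun x x' => (hfR x x').trans (hgS _ _)⟩

theorem BorelReducible.injJump (h : BorelReducible R S) :
    BorelReducible (injJump R) (injJump S) := by
  obtain ⟨f, hf, hfR⟩ := h
  exact ⟨fun x n => f (x n), measurable_pi_iff.2 fun n => hf.comp (measurable_pi_apply n),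
    fun x x' => exists_congr fun g => and_congr_right fun _ => forall_congr' fun n => hfR _ _⟩

theorem BorelReducible.assocEquiv (h : BorelReducible R S) :
    BorelReducible (assocEquiv R) (assocEquiv S) := by
  obtain ⟨f, hf, hfR⟩ := h
  exact ⟨f, hf, fun x x' => and_congr (hfR _ _) (hfR _ _)⟩

theorem BorelBireducible.symm (h : BorelBireducible R S) : BorelBireducible S R := ⟨h.2, h.1⟩

theorem BorelBireducible.trans (h : BorelBireducible R S) (h' : BorelBireducible S T) :
    BorelBireducible R T := ⟨h.1.trans h'.1, h'.2.trans h.2⟩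

theorem BorelBireducible.injJump (h : BorelBireducible R S) :
    BorelBireducible (injJump R) (injJump S) := ⟨h.1.injJump, h.2.injJump⟩

theorem BorelBireducible.assocEquiv (h : BorelBireducible R S) :
    BorelBireducible (assocEquiv R) (assocEquiv S) := ⟨h.1.assocEquiv, h.2.assocEquiv⟩

end Reducibility

/-! ### Bireducibilities between spaces, codes and jumps -/

section Bireducibility

open UltraCode

theorem embedsOn_bireducible_emb {D : Set ℝ≥0} [OrderBot D] [WellFoundedLT D] [Countable D]
    (h0 : 0 ∈ D) : BorelBireducible (embedsOn D) (Emb (L := D) False) := by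
  obtain ⟨c, hc, hcU⟩ := exists_measurable_code h0
  obtain ⟨g, hg, hgρ⟩ := exists_measurable_space h0
  exact ⟨⟨c, hc, fun U V => embedsOn_iff_emb (hcU U) (hcU V)⟩,
    ⟨g, hg, fun ρ ρ' => (embedsOn_iff_emb (hgρ ρ) (hgρ ρ')).symm⟩⟩

theorem isomOn_bireducible_emb {D : Set ℝ≥0} [OrderBot D] [WellFoundedLT D] [Countable D]
    (h0 : 0 ∈ D) : BorelBireducible (isomOn D) (Emb (L := D) True) := by
  obtain ⟨c, hc, hcU⟩ := exists_measurable_code h0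
  obtain ⟨g, hg, hgρ⟩ := exists_measurable_space h0
  exact ⟨⟨c, hc, fun U V => isomOn_iff_emb h0 (hcU U) (hcU V)⟩,
    ⟨g, hg, fun ρ ρ' => (isomOn_iff_emb h0 (hgρ ρ) (hgρ ρ')).symm⟩⟩

theorem UltraCode.emb_bireducible_of_orderIso {L L' : Type*} [LinearOrder L] [OrderBot L]
    [LinearOrder L'] [OrderBot L'] [Countable L] [Countable L'] (e : L ≃o L') (s : Prop) :
    BorelBireducible (Emb (L := L) s) (Emb (L := L') s) :=
  ⟨⟨map e, measurable_map e, emb_map e s⟩, ⟨map e.symm, measurable_map _, emb_map _ s⟩⟩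

variable {L : Type*} [LinearOrder L] [OrderBot L] [Countable L] [Nontrivial L] [WellFoundedLT L]

theorem UltraCode.emb_false_withTop_bireducible :
    BorelBireducible (Emb (L := WithTop L) False) (injJump (Emb (L := L) False)) := by
  obtain ⟨φ, hφm, hφ, hφ'⟩ := exists_thicken (L := L)
  exact ⟨⟨pieces φ, measurable_pieces hφm, fun _ _ => emb_false_iff_injJump_pieces hφ hφ'⟩,
    ⟨sum, measurable_sum, fun _ _ => injJump_iff_emb_false_sum⟩⟩

theorem UltraCode.emb_true_withTop_bireducible :
    BorelBireducible (Emb (L := WithTop L) True) (assocEquiv (injJump (Emb (L := L) True))) := by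
  obtain ⟨φ, hφm, hφ, hφ'⟩ := exists_thicken (L := L)
  exact ⟨⟨pieces φ, measurable_pieces hφm, fun _ _ => emb_true_iff_assocEquiv_pieces hφ hφ'⟩,
    ⟨sum, measurable_sum, fun _ _ => assocEquiv_iff_emb_true_sum⟩⟩

end Bireducibility

/-- The order type `α + 1` is that of the lexicographic sum of `α` and one point, which is `α` with
a top adjoined. -/
theorem Ordinal.nonempty_orderIso_withTop {α : Ordinal.{0}} {L L' : Type} [LinearOrder L]
    [LinearOrder L'] (e : α.ToType ≃o L) (e' : (α + 1).ToType ≃o L') :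
    Nonempty (L' ≃o WithTop L) := by
  have h : type (Sum.Lex (α := α.ToType) (β := PUnit) (· < ·) (· < ·)) =
      type (α := (α + 1).ToType) (· < ·) := by
    rw [type_sum_lex, type_toType, type_toType, type_eq_one_of_unique]
  obtain ⟨r⟩ := type_eq.1 h
  let E : α.ToType ⊕ₗ PUnit ≃o (α + 1).ToType :=
    OrderIso.ofRelIsoLT (Sum.Lex.toLexRelIsoLT.symm.trans r)
  exact ⟨e'.symm.trans (E.symm.trans (WithTop.orderIsoSumLexPUnit.symm.trans e.withTopCongr))⟩

theorem Ordinal.nontrivial_toType {α : Ordinal} (hα : 1 < α) : Nontrivial α.ToType := by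
  by_contra h
  rw [not_nontrivial_iff_subsingleton] at h
  have : Nonempty α.ToType := nonempty_toType_iff.2 (zero_lt_one.trans hα).ne'
  have h1 := type_eq_one_of_unique (α := α.ToType) (· < ·)
  rw [type_toType] at h1
  exact hα.ne' h1

theorem mainTheorem6 (α : Ordinal.{0}) (hα : 1 < α) (hα' : α < Ordinal.omega 1)
    (D D' : Set NNReal) (hD : D ∈ DistanceSets) (hD' : D' ∈ DistanceSets)
    (hDα : Nonempty (α.ToType ≃o D)) (hDα' : Nonempty ((α + 1).ToType ≃o D')) :
    BorelBireducible (isomOn D') (assocEquiv (injJump (isomOn D))) ∧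
    BorelBireducible (embedsOn D') (injJump (embedsOn D)) := by
  obtain ⟨e⟩ := hDα
  obtain ⟨e'⟩ := hDα'
  obtain ⟨E⟩ := Ordinal.nonempty_orderIso_withTop e e'
  have : Countable D := hD.1
  have : Countable D' := hD'.1
  have : WellFoundedLT D := ⟨(e.symm.toRelIsoLT.toRelEmbedding.wellFounded wellFounded_lt)⟩
  have : WellFoundedLT D' := ⟨(e'.symm.toRelIsoLT.toRelEmbedding.wellFounded wellFounded_lt)⟩
  -- With `0` as bottom, distance `⊥` in a code means equality of the points named.
  let _ : OrderBot D := { bot := ⟨0, hD.2⟩, bot_le := fun d => (zero_le : 0 ≤ d.1) }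
  let _ : OrderBot D' := { bot := ⟨0, hD'.2⟩, bot_le := fun d => (zero_le : 0 ≤ d.1) }
  have : Nontrivial D := by
    have := Ordinal.nontrivial_toType hα
    exact e.symm.toEquiv.nontrivial
  constructor
  · exact (isomOn_bireducible_emb hD'.2).trans <|
      (UltraCode.emb_bireducible_of_orderIso E True).trans <|
      UltraCode.emb_true_withTop_bireducible.trans
        (isomOn_bireducible_emb hD.2).injJump.assocEquiv.symm
  · exact (embedsOn_bireducible_emb hD'.2).trans <|
      (UltraCode.emb_bireducible_of_orderIso E False).trans <|
      UltraCode.emb_false_withTop_bireducible.trans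
        (embedsOn_bireducible_emb hD.2).injJump.symm
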